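/- **Setting.** Let $X_1,\dots,X_n$ be random vectors in $\mathbb R^p$ (arbitrarily dependent) with mean zero and finite second moments, $\mathcal X_n=\{X_1,\dots,X_n\}$, $S_{n,x}=n^{-1/2}\sum_{t=1}^nX_t$, $\Xi=\mathrm{Cov}(S_{n,x})$, $G\sim N(0,\Xi)$. Let $\hat\Xi_n$ be a (random) covariance matrix which is a measurable function of the data, and let $\hat G$ be a random vector with $\hat G\mid\mathcal X_n\sim N(0,\hat\Xi_n)$. For a class $\mathcal A$ of Borel sets of $\mathbb R^p$ put $$\rho_n(\mathcal A)=\sup_{A\in\mathcal A}|\mathbb P(S_{n,x}\in A)-\mathbb P(G\in A)|,\qquad \hat\rho_n(\mathcal A)=\sup_{A\in\mathcal A}|\mathbb P(S_{n,x}\in A)-\mathbb P(\hat G\in A\mid\mathcal X_n)|,$$ $\Delta_{n,r}=|\hat\Xi_n-\Xi|_\infty=\max_{i,j}|(\hat\Xi_n-\Xi)_{ij}|$ and $V_n(v)=\mathrm{Var}(n^{-1/2}\sum_{t=1}^nv^\top X_t)$ for $v\in\mathbb R^p$. **Classes.** $\mathcal A^{\rm re}$ is the class of all hyper-rectangles $\{w:a_j\le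 w_j\le b_j\ \forall j\}$, $-\infty\le a_j\le b_j\le\infty$. With the support function $\mathcal S_A(v)=\sup_{w\in A}w^\top v$, a $K$-generated set is a set $A^K=\bigcap_{v\in\mathcal V(A^K)}\{w:w^\top v\le\mathcal S_{A^K}(v)\}$, given with the set $\mathcal V(A^K)$ of its $K$ unit normal vectors, and $A^{K,\epsilon}=\bigcap_{v\in\mathcal V(A^K)}\{w:w^\top v\le\mathcal S_{A^K}(v)+\epsilon\}$. For $a\ge0$, $d>0$, $\mathcal A^{\rm si}(a,d)$ is the class of all Borel sets $A$ for which there is a $K$-generated $A^K=A^K(A)$ with $K\le(pn)^d$ and $A^K\subset A\subset A^{K,a/n}$; such a choice $A\mapsto A^K(A)$ is fixed, and for $\mathcal A\subset\mathcal A^{\rm si}(a,d)$ let $\Delta_n(\mathcal A)=\sup_{A\in\mathcal A}\sup_{v_1,v_2\in\mathcal V\{A^K(A)\}}|v_1^\top(\hat\Xi_n-\Xi)v_2|$. For an integer $s\ge1$, $\mathcal A^{\rm sp}(s)$ is the class of all Borel sets that are finite intersections of convex sets, each of whose indicator functions depends on at most $s$ coordinates. **Theorem.** Let $\kappa,K_3,K_4,K_5>0$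 and $\gamma_1\ge1$. There is a constant $c>0$ depending only on these numbers such that, for all $n\ge1$ and $p\ge2$ with $p\ge n^\kappa$, the following hold almost surely. (i) If $V_n(e_j)\ge K_3$ for every coordinate vector $e_j$, $1\le j\le p$, then $$\hat\rho_n(\mathcal A^{\rm re})\le c\,\{\rho_n(\mathcal A^{\rm re})+\Delta_{n,r}^{1/3}(\log p)^{2/3}\}.$$ (ii) Let $a\ge0$, $d>0$ with $d\log p\ge1$ (for fixed $d$ this holds for all large $n$), and let $\mathcal A\subset\mathcal A^{\rm si}(a,d)$ be such that $V_n(v)\ge K_4$ for all $A\in\mathcal A$ and $v\in\mathcal V\{A^K(A)\}$. Then $$\hat\rho_n(\mathcal A)\le c\,\{\rho_n(\mathcal A)+an^{-1}(d\log p)^{1/2}+\Delta_n(\mathcal A)^{1/3}(d\log p)^{2/3}\}.$$ (iii) Let $s\ge1$ be an integer and $B_n\ge1$. If $\|X_{t,j}\|_{\psi_{\gamma_1}}\le B_n$ for all $t,j$, where $\|\xi\|_{\psi_\gamma}=\inf\{\lambda>0:\mathbb E[\exp\{(|\xi|/\lambda)^\gamma\}-1]\le1\}$, and $V_n(v)\ge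 K_5$ for all unit vectors $v$ with at most $s$ non-zero coordinates, then $$\hat\rho_n\{\mathcal A^{\rm sp}(s)\}\le c\,[\rho_n\{\mathcal A^{\rm sp}(s)\}+s^2\Delta_{n,r}^{1/3}(\log p)^{2/3}+\{B_n+s(\log p)^{1/2}\}n^{-1}].$$ -/

import Mathlib

open MeasureTheory ProbabilityTheory Matrix

namespace HDBootstrap

/-- `ℝᵖ` with its Euclidean structure. -/
abbrev RVec (p : ℕ) : Type := EuclideanSpace ℝ (Fin p)

noncomputable section

/-! ### Partial sums, long-run variances and covariances -/

/-- `S_{n,x} = n^{-1/2} ∑_{t=1}^n X_t`. -/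
def scaledSum {n p : ℕ} {Ω : Type*} (X : Fin n → Ω → RVec p) (ω : Ω) : RVec p :=
  (Real.sqrt n)⁻¹ • ∑ t, X t ω

/-- The data `𝒳_n = (X_1, …, X_n)` as one random element. -/
def sample {n p : ℕ} {Ω : Type*} (X : Fin n → Ω → RVec p) (ω : Ω) : Fin n → RVec p :=
  fun t => X t ω

/-- The long-run covariance matrix `Ξ = Cov(S_{n,x})`. -/
def longRunCov {n p : ℕ} {Ω : Type*} [MeasurableSpace Ω] (P : Measure Ω)
    (X : Fin n → Ω → RVec p) : Matrix (Fin p) (Fin p) ℝ :=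
  Matrix.of fun i j => cov[fun ω => scaledSum X ω i, fun ω => scaledSum X ω j; P]

/-- `V_{n,j} = Var(n^{-1/2} ∑_t X_{t,j})`. -/
def coordLongRunVar {n p : ℕ} {Ω : Type*} [MeasurableSpace Ω] (P : Measure Ω)
    (X : Fin n → Ω → RVec p) (j : Fin p) : ℝ :=
  Var[fun ω => (Real.sqrt n)⁻¹ * ∑ t, X t ω j; P]

/-- `V_n(v) = Var(n^{-1/2} ∑_t vᵀ X_t)`. -/
def dirLongRunVar {n p : ℕ} {Ω : Type*} [MeasurableSpace Ω] (P : Measure Ω)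
    (X : Fin n → Ω → RVec p) (v : RVec p) : ℝ :=
  Var[fun ω => (Real.sqrt n)⁻¹ * ∑ t, inner ℝ v (X t ω); P]

/-- The Orlicz norm `‖ξ‖_{ψ_α} = inf {λ > 0 : E[exp((|ξ|/λ)^α) - 1] ≤ 1}`, with value `∞` if there
is no such `λ`. -/
def psiNorm {Ω : Type*} [MeasurableSpace Ω] (P : Measure Ω) (α : ℝ) (ξ : Ω → ℝ) : ENNReal :=
  ⨅ (l : ℝ) (_ : 0 < l)
    (_ : ∫⁻ ω, ENNReal.ofReal (Real.exp ((|ξ ω| / l) ^ α) - 1) ∂P ≤ 1), ENNReal.ofReal l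

/-- `|M|_∞ = max_{i,j} |M_{ij}|`. -/
def supNorm {p : ℕ} (M : Matrix (Fin p) (Fin p) ℝ) : ℝ := ⨆ i, ⨆ j, |M i j|

/-- `|v|_0`, the number of non-zero coordinates. -/
def l0Norm {p : ℕ} (v : RVec p) : ℕ := (Finset.univ.filter fun j => v j ≠ 0).card

/-! ### Uniform distance over a class of sets -/

/-- `sup_{A ∈ 𝒜} |μ(A) - ν(A)|`. -/
def distOver {p : ℕ} (𝒜 : Set (Set (RVec p))) (μ ν : Measure (RVec p)) : ℝ :=
  sSup {r | ∃ A ∈ 𝒜, r = |μ.real A - ν.real A|}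

/-- `ρ_n(𝒜) = sup_{A ∈ 𝒜} |P(S_{n,x} ∈ A) - P(G ∈ A)|`, where `G ~ N(0, Ξ)`. -/
def rho {n p : ℕ} {Ω : Type*} [MeasurableSpace Ω] (P : Measure Ω) (X : Fin n → Ω → RVec p)
    (𝒜 : Set (Set (RVec p))) : ℝ :=
  distOver 𝒜 (P.map (scaledSum X)) (multivariateGaussian 0 (longRunCov P X))

/-- `ρ̂_n(𝒜) = sup_{A ∈ 𝒜} |P(S_{n,x} ∈ A) - P(Ĝ ∈ A | 𝒳_n)|`, a function of the outcome `ω`;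
the conditional probabilities are those of the regular conditional distribution of `Ĝ` given
`𝒳_n`. -/
def rhoHat {n p : ℕ} {Ω : Type*} [MeasurableSpace Ω] (P : Measure Ω) [IsFiniteMeasure P]
    (X : Fin n → Ω → RVec p) (Ghat : Ω → RVec p) (𝒜 : Set (Set (RVec p))) (ω : Ω) : ℝ :=
  distOver 𝒜 (P.map (scaledSum X)) (condDistrib Ghat (sample X) P (sample X ω))

/-! ### Hyper-rectangles -/

/-- The class of all hyper-rectangles `{w : a_j ≤ w_j ≤ b_j for all j}`,
`-∞ ≤ a_j ≤ b_j ≤ ∞`. -/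
def hyperRectangles (p : ℕ) : Set (Set (RVec p)) :=
  {A | ∃ a b : Fin p → EReal, (∀ j, a j ≤ b j) ∧
    A = {w | ∀ j, a j ≤ ((w j : ℝ) : EReal) ∧ ((w j : ℝ) : EReal) ≤ b j}}

/-! ### Simple convex sets -/

/-- The support function `v ↦ sup {wᵀ v : w ∈ A}`, with values in the extended reals. -/
def supportFn {p : ℕ} (A : Set (RVec p)) (v : RVec p) : EReal :=
  ⨆ w ∈ A, ((inner ℝ w v : ℝ) : EReal)

/-- A `K`-generated convex set `A^K` together with its set `𝒱(A^K)` of unit (outward normal)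
vectors, `K = |𝒱(A^K)|`, so that `A^K = ⋂_{v ∈ 𝒱(A^K)} {w : wᵀ v ≤ 𝒮_{A^K}(v)}`. -/
structure GeneratedSet (p : ℕ) where
  /-- the set `A^K` -/
  carrier : Set (RVec p)
  /-- the set `𝒱(A^K)` -/
  normals : Finset (RVec p)
  norm_eq_one : ∀ v ∈ normals, ‖v‖ = 1
  carrier_eq : carrier =
    {w | ∀ v ∈ normals, ((inner ℝ w v : ℝ) : EReal) ≤ supportFn carrier v}

/-- `A^{K,ε} = ⋂_{v ∈ 𝒱(A^K)} {w : wᵀ v ≤ 𝒮_{A^K}(v) + ε}`. -/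
def GeneratedSet.enlarge {p : ℕ} (Q : GeneratedSet p) (ε : ℝ) : Set (RVec p) :=
  {w | ∀ v ∈ Q.normals, ((inner ℝ w v : ℝ) : EReal) ≤ supportFn Q.carrier v + (ε : EReal)}

/-- `Q = A^K` approximates `A`: `K ≤ (pn)^d` and `A^K ⊆ A ⊆ A^{K,ε}` with `ε = a/n`. -/
def SimpleApprox {p : ℕ} (n : ℕ) (a d : ℝ) (Q : GeneratedSet p) (A : Set (RVec p)) : Prop :=
  (Q.normals.card : ℝ) ≤ ((p : ℝ) * (n : ℝ)) ^ d ∧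
    Q.carrier ⊆ A ∧ A ⊆ Q.enlarge (a / n)

/-- The class `𝒜^si(a,d)` of (Borel) simple convex sets. -/
def simpleConvexSets (n p : ℕ) (a d : ℝ) : Set (Set (RVec p)) :=
  {A | MeasurableSet A ∧ ∃ Q : GeneratedSet p, SimpleApprox n a d Q A}

/-- `Δ_n(𝒜) = sup_{A ∈ 𝒜} sup_{v₁, v₂ ∈ 𝒱(A^K(A))} |v₁ᵀ M v₂|`, to be used with
`M = Ξ̂_n - Ξ`. -/
def deltaOver {p : ℕ} (AK : Set (RVec p) → GeneratedSet p) (𝒜 : Set (Set (RVec p)))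
    (M : Matrix (Fin p) (Fin p) ℝ) : ℝ :=
  sSup {r | ∃ A ∈ 𝒜, ∃ v₁ ∈ (AK A).normals, ∃ v₂ ∈ (AK A).normals,
    r = |v₁.ofLp ⬝ᵥ (M *ᵥ v₂.ofLp)|}

/-! ### Sparsely convex sets -/

/-- The indicator of `A` depends on at most `s` coordinates. -/
def DependsOnAtMost {p : ℕ} (s : ℕ) (A : Set (RVec p)) : Prop :=
  ∃ J : Finset (Fin p), J.card ≤ s ∧
    ∀ w w' : RVec p, (∀ j ∈ J, w j = w' j) → (w ∈ A ↔ w' ∈ A)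

/-- The class `𝒜^sp(s)` of (Borel) `s`-sparsely convex sets: finite intersections of convex sets,
each of which depends on at most `s` coordinates. -/
def sparselyConvexSets (p s : ℕ) : Set (Set (RVec p)) :=
  {A | MeasurableSet A ∧ ∃ K : ℕ, 0 < K ∧ ∃ C : Fin K → Set (RVec p),
    (∀ q, Convex ℝ (C q)) ∧ (∀ q, DependsOnAtMost s (C q)) ∧ A = ⋂ q, C q}

end

end HDBootstrap

open HDBootstrap

namespace HDBootstrap

/-! ### A smooth cut-off of the log-sum-exp function -/

/-! By the triangle inequality, the bootstrap distance exceeds `rho` by at most the distance between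
N(0, Ξ̂) and N(0, Ξ) over the class. Once the data are fixed, only a deterministic comparison of two
centred Gaussian measures remains, with S = Ξ and T = Ξ̂. The data enter only through variance
bounds on S.

The core case is a polyhedron ⟨x, vᵢ⟩ ≤ bᵢ with at most exp L constraints. Its indicator is replaced
by t applied to the log-sum-exp of β(⟨x, vᵢ⟩ − bᵢ), where t falls from 1 at L to 0 at 2L and β =
2L/δ. This function is 1 on the polyhedron and 0 off its δ-enlargement. The Hessian of log-sum-exp
is built from soft-max averages, so the second-order effect of replacing S by T is governed by Δ =
maxᵢⱼ |vᵢᵀ(T − S)vⱼ|, whatever the number of constraints. Lindeberg interpolation removes the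
third-order terms, which leaves an error of order ΔL/δ². Nazarov's inequality under S, applied on
both sides, converts the enlargement into an error of order δ√L. The choice δ = (Δ√L)^(1/3) balances
the two and yields Δ^(1/3) L^(2/3) (`exists_abs_measureReal_polyhedron_sub_le`). T may be
degenerate, because anti-concentration is used only for S.

Nazarov's inequality is proved by shifting. Moving x by h S uⱼ raises the j-th normalised variable
by h and every other one by at most h, so a maximum attained at j stays at j. Hence a thin slab for
the maximum has comparable mass to many disjoint slabs above it, and its own mass must be small.

Each class reduces to polyhedra. Rectangles have 2p normals ±eⱼ. Simple convex sets are sandwiched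
by definition, with L a multiple of d log p. Sparsely convex sets are sandwiched inside a box of
radius p n² by supporting half-spaces whose normals lie in a finite net of s-sparse unit vectors,
with L a multiple of s log p. The box has small exceptional mass under S by Chebyshev's inequality,
and under T because the box is a rectangle. -/

lemma exists_bound_of_contDiff_of_const_outside {f : ℝ → ℝ} (hf : ContDiff ℝ 3 f)
    (h0 : ∀ x ≤ 0, f x = 0) (h1 : ∀ x, 1 ≤ x → f x = 1) (k : ℕ) (hk : 0 < k) (hk3 : k ≤ 3) :
    ∃ D : ℝ, ∀ x, |iteratedDeriv k f x| ≤ D := by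
  have hc : Continuous (iteratedDeriv k f) := hf.continuous_iteratedDeriv k (by exact_mod_cast hk3)
  obtain ⟨D, hD⟩ := isCompact_Icc.exists_bound_of_continuousOn (s := Set.Icc (0 : ℝ) 1)
    hc.continuousOn
  refine ⟨max D 0, fun x => ?_⟩
  by_cases hx : x ∈ Set.Icc (0 : ℝ) 1
  · exact (hD x hx).trans (le_max_left _ _)
  have hz : iteratedDeriv k f x = 0 := by
    have hconst : ∃ c : ℝ, f =ᶠ[nhds x] fun _ => c := by
      rw [Set.mem_Icc, not_and_or, not_le, not_le] at hx
      rcases hx with hx | hx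
      · exact ⟨0, by filter_upwards [Iio_mem_nhds hx] with y hy using h0 y hy.le⟩
      · exact ⟨1, by filter_upwards [Ioi_mem_nhds hx] with y hy using h1 y hy.le⟩
    obtain ⟨c, hc⟩ := hconst
    rw [hc.iteratedDeriv_eq k, iteratedDeriv_const]
    simp [hk.ne']
  rw [hz, abs_zero]
  exact le_max_right _ _

/-- A thrice differentiable step function from `1` to `0` with bounded derivatives. -/
lemma exists_smooth_step : ∃ (D : ℝ) (g g1 g2 g3 : ℝ → ℝ), 0 < D ∧
    (∀ x, HasDerivAt g (g1 x) x) ∧ (∀ x, HasDerivAt g1 (g2 x) x) ∧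
    (∀ x, HasDerivAt g2 (g3 x) x) ∧ (∀ x, |g1 x| ≤ D) ∧ (∀ x, |g2 x| ≤ D) ∧ (∀ x, |g3 x| ≤ D) ∧
    (∀ x, 0 ≤ g x) ∧ (∀ x, g x ≤ 1) ∧ (∀ x ≤ 0, g x = 1) ∧ (∀ x, 1 ≤ x → g x = 0) := by
  have hf : ContDiff ℝ 3 Real.smoothTransition := Real.smoothTransition.contDiff (n := 3)
  have hb := exists_bound_of_contDiff_of_const_outside hf
    (fun _ => Real.smoothTransition.zero_of_nonpos) fun _ => Real.smoothTransition.one_of_one_le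
  obtain ⟨D1, hD1⟩ := hb 1 (by norm_num) (by norm_num)
  obtain ⟨D2, hD2⟩ := hb 2 (by norm_num) (by norm_num)
  obtain ⟨D3, hD3⟩ := hb 3 (by norm_num) (by norm_num)
  have hder : ∀ k : ℕ, k < 3 → ∀ x, HasDerivAt (iteratedDeriv k Real.smoothTransition)
      (iteratedDeriv (k + 1) Real.smoothTransition x) x := fun k hk x => by
    rw [iteratedDeriv_succ]
    exact ((hf.differentiable_iteratedDeriv k (by exact_mod_cast hk)) x).hasDerivAt
  refine ⟨|D1| + |D2| + |D3| + 1, fun x => 1 - Real.smoothTransition x,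
    fun x => -iteratedDeriv 1 Real.smoothTransition x,
    fun x => -iteratedDeriv 2 Real.smoothTransition x,
    fun x => -iteratedDeriv 3 Real.smoothTransition x, by positivity, fun x => ?_,
    fun x => (hder 1 (by norm_num) x).neg, fun x => (hder 2 (by norm_num) x).neg,
    fun x => ?_, fun x => ?_, fun x => ?_, fun x => ?_, fun x => ?_, fun x hx => ?_,
    fun x hx => ?_⟩
  · have := hder 0 (by norm_num) x
    rw [iteratedDeriv_zero] at this
    exact this.const_sub 1
  · rw [abs_neg]
    linarith [hD1 x, le_abs_self D1, abs_nonneg D2, abs_nonneg D3]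
  · rw [abs_neg]
    linarith [hD2 x, le_abs_self D2, abs_nonneg D1, abs_nonneg D3]
  · rw [abs_neg]
    linarith [hD3 x, le_abs_self D3, abs_nonneg D2, abs_nonneg D1]
  · linarith [Real.smoothTransition.le_one x]
  · linarith [Real.smoothTransition.nonneg x]
  · simp [Real.smoothTransition.zero_of_nonpos hx]
  · simp [Real.smoothTransition.one_of_one_le hx]

/-- Three applications of the mean value inequality on [0, 1], each passing the bound C from a
derivative to its primitive because s ≤ 1. The factor 1/6 is given up. -/
lemma abs_sub_taylor_two_le {u u1 u2 u3 : ℝ → ℝ} {C : ℝ} (h0 : ∀ s, HasDerivAt u (u1 s) s)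
    (h1 : ∀ s, HasDerivAt u1 (u2 s) s) (h2 : ∀ s, HasDerivAt u2 (u3 s) s)
    (hC : ∀ s, |u3 s| ≤ C) : |u 1 - u 0 - u1 0 - u2 0 / 2| ≤ C := by
  have hC0 : 0 ≤ C := (abs_nonneg _).trans (hC 0)
  have key : ∀ {w w' : ℝ → ℝ}, (∀ s, HasDerivAt w (w' s) s) → w 0 = 0 →
      (∀ s ∈ Set.Icc (0 : ℝ) 1, |w' s| ≤ C) → ∀ s ∈ Set.Icc (0 : ℝ) 1, |w s| ≤ C := by
    intro w w' hw hw0 hb s hs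
    have := (convex_Icc (0 : ℝ) 1).norm_image_sub_le_of_norm_hasDerivWithin_le
      (fun x hx => (hw x).hasDerivWithinAt) hb (Set.left_mem_Icc.2 zero_le_one) hs
    rw [hw0, sub_zero, sub_zero, Real.norm_eq_abs, Real.norm_eq_abs, abs_of_nonneg hs.1] at this
    exact this.trans (mul_le_of_le_one_right hC0 hs.2)
  have k2 := key (w := fun s => u2 s - u2 0) (fun s => (h2 s).sub_const _) (by simp)
    fun s _ => hC s
  have k1 := key (w := fun s => u1 s - u1 0 - s * u2 0) (w' := fun s => u2 s - u2 0)
    (fun s => by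
      exact (((h1 s).sub_const (u1 0)).sub ((hasDerivAt_id s).mul_const (u2 0))).congr_deriv
        (by ring))
    (by simp) k2
  have k0 := key (w := fun s => u s - u 0 - s * u1 0 - s ^ 2 / 2 * u2 0)
    (w' := fun s => u1 s - u1 0 - s * u2 0)
    (fun s => by
      have := (((h0 s).sub_const (u 0)).sub ((hasDerivAt_id s).mul_const (u1 0))).sub
        ((((hasDerivAt_id s).pow 2).div_const 2).mul_const (u2 0))
      exact this.congr_deriv (by simp only [id]; norm_num))
    (by simp) k1 1 (by simp)
  convert k0 using 2
  ring

/-! ### Derivatives of log-sum-exp along a line -/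

section Tilt

variable {ι : Type*} [Fintype ι]

/-- `∑ᵢ aᵢ cᵢᵏ exp(s cᵢ)`. -/
noncomputable def expSum (a c : ι → ℝ) (k : ℕ) (s : ℝ) : ℝ :=
  ∑ i, a i * c i ^ k * Real.exp (s * c i)

/-- The `k`-th moment of `c` under the weights proportional to `aᵢ exp(s cᵢ)`. -/
noncomputable def tiltMoment (a c : ι → ℝ) (k : ℕ) (s : ℝ) : ℝ :=
  expSum a c k s / expSum a c 0 s

variable {a c : ι → ℝ}

lemma expSum_pos [Nonempty ι] (ha : ∀ i, 0 < a i) (s : ℝ) : 0 < expSum a c 0 s := by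
  refine Finset.sum_pos (fun i _ => ?_) Finset.univ_nonempty
  have := ha i
  positivity

lemma hasDerivAt_expSum (k : ℕ) (s : ℝ) :
    HasDerivAt (expSum a c k) (expSum a c (k + 1) s) s := by
  unfold expSum
  refine HasDerivAt.fun_sum fun i _ => ?_
  have := (((hasDerivAt_id s).mul_const (c i)).exp).const_mul (a i * c i ^ k)
  exact this.congr_deriv (by simp only [id]; ring)

/-- Differentiating an average under exponential tilting produces a covariance, here that of cᵏ and
c under the tilted weights. This expresses all derivatives of log-sum-exp through tilted moments. -/
lemma hasDerivAt_tiltMoment [Nonempty ι] (ha : ∀ i, 0 < a i) (k : ℕ) (s : ℝ) :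
    HasDerivAt (tiltMoment a c k)
      (tiltMoment a c (k + 1) s - tiltMoment a c k s * tiltMoment a c 1 s) s := by
  have hp := (expSum_pos (c := c) ha s).ne'
  have := (hasDerivAt_expSum (a := a) (c := c) k s).div (hasDerivAt_expSum 0 s) hp
  refine this.congr_deriv ?_
  simp only [tiltMoment]
  field_simp

lemma hasDerivAt_log_expSum [Nonempty ι] (ha : ∀ i, 0 < a i) (s : ℝ) :
    HasDerivAt (fun s => Real.log (expSum a c 0 s)) (tiltMoment a c 1 s) s :=
  (hasDerivAt_expSum 0 s).log (expSum_pos ha s).ne'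

/-- The tilted weights form a probability vector, so the bound does not see the number of terms.
This is why the number of constraints enters the comparison only through L. -/
lemma abs_tiltMoment_le [Nonempty ι] (ha : ∀ i, 0 < a i) {M : ℝ} (hM : ∀ i, |c i| ≤ M) (k : ℕ)
    (s : ℝ) : |tiltMoment a c k s| ≤ M ^ k := by
  unfold tiltMoment
  rw [abs_div, abs_of_pos (expSum_pos ha s), div_le_iff₀ (expSum_pos ha s)]
  unfold expSum
  rw [Finset.mul_sum]
  refine (Finset.abs_sum_le_sum_abs _ _).trans (Finset.sum_le_sum fun i _ => ?_)
  rw [abs_mul, abs_mul, abs_of_pos (ha i), abs_of_pos (Real.exp_pos _), abs_pow]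
  have h := pow_le_pow_left₀ (abs_nonneg _) (hM i) k
  have : 0 ≤ a i * Real.exp (s * c i) := mul_nonneg (ha i).le (Real.exp_pos _).le
  nlinarith

/-- Second order expansion of a smooth function of a log-sum-exp. -/
lemma abs_log_expSum_taylor_le [Nonempty ι] (ha : ∀ i, 0 < a i) {M D : ℝ} (hM : ∀ i, |c i| ≤ M)
    {t t1 t2 t3 : ℝ → ℝ} (h0 : ∀ x, HasDerivAt t (t1 x) x) (h1 : ∀ x, HasDerivAt t1 (t2 x) x)
    (h2 : ∀ x, HasDerivAt t2 (t3 x) x) (b1 : ∀ x, |t1 x| ≤ D) (b2 : ∀ x, |t2 x| ≤ D)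
    (b3 : ∀ x, |t3 x| ≤ D) :
    |t (Real.log (expSum a c 0 1)) - t (Real.log (expSum a c 0 0)) -
      t1 (Real.log (expSum a c 0 0)) * tiltMoment a c 1 0 -
      (t2 (Real.log (expSum a c 0 0)) * tiltMoment a c 1 0 ^ 2 +
        t1 (Real.log (expSum a c 0 0)) * (tiltMoment a c 2 0 - tiltMoment a c 1 0 ^ 2)) / 2| ≤
      13 * D * M ^ 3 := by
  set l : ℝ → ℝ := fun s => Real.log (expSum a c 0 s) with hl
  set q : ℕ → ℝ → ℝ := tiltMoment a c with hq
  have dl : ∀ s, HasDerivAt l (q 1 s) s := hasDerivAt_log_expSum ha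
  have dq : ∀ k s, HasDerivAt (q k) (q (k + 1) s - q k s * q 1 s) s := hasDerivAt_tiltMoment ha
  -- The third derivative of t ∘ l has the terms t‴ l′³, 3 t″ l′ l″ and t′ l‴. They contribute at
  -- most 1, 3·2 and 1 + 3 + 2 = 6 times D M³, which gives 13.
  refine abs_sub_taylor_two_le (u := fun s => t (l s)) (u1 := fun s => t1 (l s) * q 1 s)
    (u2 := fun s => t2 (l s) * q 1 s ^ 2 + t1 (l s) * (q 2 s - q 1 s ^ 2))
    (u3 := fun s => t3 (l s) * q 1 s ^ 3 + 3 * (t2 (l s) * (q 1 s * (q 2 s - q 1 s ^ 2))) +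
      t1 (l s) * (q 3 s - 3 * (q 2 s * q 1 s) + 2 * q 1 s ^ 3))
    (fun s => (h0 (l s)).comp s (dl s)) (fun s => ?_) (fun s => ?_) (fun s => ?_)
  · refine (((h1 (l s)).comp s (dl s)).mul (dq 1 s)).congr_deriv ?_
    simp only [Function.comp]
    ring
  · refine ((((h2 (l s)).comp s (dl s)).mul ((dq 1 s).pow 2)).add
      (((h1 (l s)).comp s (dl s)).mul ((dq 2 s).sub ((dq 1 s).pow 2)))).congr_deriv ?_
    simp only [Function.comp, Pi.pow_apply, Pi.sub_apply]
    push_cast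
    ring
  · have m1 := abs_tiltMoment_le ha hM 1 s
    have m2 := abs_tiltMoment_le ha hM 2 s
    have m3 := abs_tiltMoment_le ha hM 3 s
    rw [← hq] at m1 m2 m3
    rw [pow_one] at m1
    have hM0 : 0 ≤ M := (abs_nonneg _).trans m1
    have e1 : |q 1 s| ^ 2 ≤ M ^ 2 := pow_le_pow_left₀ (abs_nonneg _) m1 2
    have e2 : |q 1 s| ^ 3 ≤ M ^ 3 := pow_le_pow_left₀ (abs_nonneg _) m1 3
    have e3 : |q 2 s - q 1 s ^ 2| ≤ 2 * M ^ 2 := by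
      refine (abs_sub _ _).trans ?_
      rw [abs_pow]
      linarith
    have e4 : |q 1 s * (q 2 s - q 1 s ^ 2)| ≤ 2 * M ^ 3 := by
      rw [abs_mul]
      calc _ ≤ M * (2 * M ^ 2) := mul_le_mul m1 e3 (abs_nonneg _) hM0
        _ = _ := by ring
    have e5 : |q 3 s - 3 * (q 2 s * q 1 s) + 2 * q 1 s ^ 3| ≤ 6 * M ^ 3 := by
      have : |q 2 s * q 1 s| ≤ M ^ 3 := by
        rw [abs_mul]
        calc _ ≤ M ^ 2 * M := mul_le_mul m2 m1 (abs_nonneg _) (by positivity)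
          _ = _ := by ring
      rw [← abs_pow] at e2
      rw [abs_le] at *
      constructor <;> linarith [this.1, this.2, m3.1, m3.2, e2.1, e2.2]
    have hmul : ∀ {x y A : ℝ}, |x| ≤ D → |y| ≤ A → |x * y| ≤ D * A := fun hx hy => by
      rw [abs_mul]
      exact mul_le_mul hx hy (abs_nonneg _) ((abs_nonneg _).trans hx)
    rw [← abs_pow] at e2
    have f1 := hmul (b3 (l s)) e2
    have f2 := hmul (b2 (l s)) e4
    have f3 := hmul (b1 (l s)) e5
    rw [abs_le] at *
    constructor <;> linarith [f1.1, f1.2, f2.1, f2.2, f3.1, f3.2]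

end Tilt

/-! ### Centred multivariate Gaussian measures -/

section Gaussian

variable {p : ℕ} {S T : Matrix (Fin p) (Fin p) ℝ}

lemma multivariateGaussian_conv (hS : S.PosSemidef) (hT : T.PosSemidef) :
    (multivariateGaussian 0 S) ∗ (multivariateGaussian 0 T) =
      (multivariateGaussian 0 (S + T) : Measure (RVec p)) := by
  apply Measure.ext_of_charFun
  ext x
  rw [charFun_conv, charFun_multivariateGaussian hS, charFun_multivariateGaussian hT,
    charFun_multivariateGaussian (hS.add hT), ← Complex.exp_add, Matrix.add_mulVec,
    dotProduct_add]
  congr 1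
  push_cast
  simp only [inner_zero_right]
  push_cast
  ring

lemma multivariateGaussian_smul (hS : S.PosSemidef) (r : ℝ) :
    (multivariateGaussian 0 (r ^ 2 • S) : Measure (RVec p)) =
      (multivariateGaussian 0 S).map (r • ·) := by
  apply Measure.ext_of_charFun
  ext x
  rw [charFun_map_smul, charFun_multivariateGaussian hS,
    charFun_multivariateGaussian (hS.smul (sq_nonneg r))]
  congr 1
  simp only [inner_zero_right, Matrix.smul_mulVec, dotProduct_smul, WithLp.ofLp_smul,
    Matrix.mulVec_smul, smul_dotProduct, smul_eq_mul]
  push_cast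
  ring

lemma integral_inner_multivariateGaussian (v : RVec p) :
    ∫ y, inner ℝ y v ∂(multivariateGaussian 0 S : Measure (RVec p)) = 0 := by
  have h := ContinuousLinearMap.integral_comp_id_comm
    (IsGaussian.integrable_id (μ := (multivariateGaussian 0 S : Measure (RVec p))))
    (innerSL ℝ v)
  rw [integral_id_multivariateGaussian, map_zero] at h
  simpa [innerSL_apply_apply, real_inner_comm] using h

lemma memLp_inner_multivariateGaussian (v : RVec p) :
    MemLp (fun y => inner ℝ y v) 2 (multivariateGaussian 0 S : Measure (RVec p)) := by
  have := (IsGaussian.memLp_two_id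
    (μ := (multivariateGaussian 0 S : Measure (RVec p)))).inner_const (𝕜 := ℝ) v
  exact this

lemma integral_inner_mul_inner_multivariateGaussian (hS : S.PosSemidef) (v w : RVec p) :
    ∫ y, inner ℝ y v * inner ℝ y w ∂(multivariateGaussian 0 S : Measure (RVec p)) =
      v.ofLp ⬝ᵥ (S *ᵥ w.ofLp) := by
  rw [← covarianceBilin_multivariateGaussian hS (μ := 0),
    covarianceBilin_apply_eq_cov IsGaussian.memLp_two_id]
  have c : ∀ u : RVec p, (fun y => inner ℝ u y) = fun y : RVec p => inner ℝ y u :=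
    fun u => funext fun y => real_inner_comm y u
  rw [c v, c w, covariance_eq_sub (memLp_inner_multivariateGaussian v) (memLp_inner_multivariateGaussian w),
    integral_inner_multivariateGaussian]
  simp

lemma integrable_norm_pow_multivariateGaussian (k : ℕ) :
    Integrable (fun y => ‖y‖ ^ k) (multivariateGaussian 0 S : Measure (RVec p)) := by
  exact (IsGaussian.memLp_id (multivariateGaussian 0 S : Measure (RVec p)) k
    (by simp)).integrable_norm_pow'

lemma map_inner_multivariateGaussian (hS : S.PosSemidef) (v : RVec p) :
    (multivariateGaussian 0 S : Measure (RVec p)).map (fun y => inner ℝ y v) =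
      gaussianReal 0 (v.ofLp ⬝ᵥ (S *ᵥ v.ofLp)).toNNReal := by
  have h := IsGaussian.map_eq_gaussianReal
    (μ := (multivariateGaussian 0 S : Measure (RVec p))) (innerSL ℝ v)
  have e : ⇑(innerSL ℝ v) = fun y : RVec p => inner ℝ y v := by
    ext y
    simp [innerSL_apply_apply, real_inner_comm]
  rw [e] at h
  rw [h, integral_inner_multivariateGaussian,
    ← covarianceBilin_multivariateGaussian hS (μ := 0),
    covarianceBilin_self IsGaussian.memLp_two_id]
  simp_rw [real_inner_comm]

end Gaussian

/-! ### Gaussian comparison for smooth functions -/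

section Comparison

variable {p : ℕ} {ι : Type*} [Fintype ι]

/-- A function `t` of the log-sum-exp of the numbers `β (⟨x, vᵢ⟩ - bᵢ)`. -/
noncomputable def smoothInd (t : ℝ → ℝ) (β : ℝ) (v : ι → RVec p) (b : ι → ℝ) (x : RVec p) : ℝ :=
  t (Real.log (∑ i, Real.exp (β * (inner ℝ x (v i) - b i))))

/-- The soft-max weights of the numbers `β (⟨x, vᵢ⟩ - bᵢ)`. -/
noncomputable def softWeight (β : ℝ) (v : ι → RVec p) (b : ι → ℝ) (x : RVec p) (i : ι) : ℝ :=
  Real.exp (β * (inner ℝ x (v i) - b i)) / ∑ j, Real.exp (β * (inner ℝ x (v j) - b j))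

variable {β : ℝ} {v : ι → RVec p} {b : ι → ℝ}

lemma sum_exp_pos [Nonempty ι] (r : ι → ℝ) : 0 < ∑ i, Real.exp (r i) :=
  Finset.sum_pos (fun _ _ => Real.exp_pos _) Finset.univ_nonempty

lemma softWeight_nonneg (x : RVec p) (i : ι) : 0 ≤ softWeight β v b x i :=
  div_nonneg (Real.exp_pos _).le (Finset.sum_nonneg fun _ _ => (Real.exp_pos _).le)

lemma sum_softWeight [Nonempty ι] (x : RVec p) : ∑ i, softWeight β v b x i = 1 := by
  unfold softWeight
  rw [← Finset.sum_div, div_self (sum_exp_pos _).ne']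

lemma continuous_smoothInd [Nonempty ι] {t : ℝ → ℝ} (ht : Continuous t) :
    Continuous (smoothInd t β v b) := by
  unfold smoothInd
  refine ht.comp (Continuous.log (by fun_prop) fun x => (sum_exp_pos _).ne')

/-- The Hessian of `smoothInd` contracted with `S`, where `w` are the weights and `A`, `B` are the
first two derivatives of `t`. -/
noncomputable def contractedHessian (β A B : ℝ) (w : ι → ℝ) (v : ι → RVec p)
    (S : Matrix (Fin p) (Fin p) ℝ) : ℝ :=
  β ^ 2 * ((B - A) * ∑ i, ∑ j, w i * w j * ((v i).ofLp ⬝ᵥ (S *ᵥ (v j).ofLp)) +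
    A * ∑ i, w i * ((v i).ofLp ⬝ᵥ (S *ᵥ (v i).ofLp)))

/-- The contraction is linear in the matrix and consists of soft-max averages of the numbers vᵢᵀ(S −
T)vⱼ. Since the weights sum to 1, each average is at most Δ. The factor 3 comes from |B − A| ≤ 2D
and |A| ≤ D. -/
lemma abs_contractedHessian_sub_le {A B D Δ : ℝ} {w : ι → ℝ} (hw : ∀ i, 0 ≤ w i)
    (hw1 : ∑ i, w i = 1) (hA : |A| ≤ D) (hB : |B| ≤ D) {S T : Matrix (Fin p) (Fin p) ℝ}
    (hΔ : ∀ i j, |(v i).ofLp ⬝ᵥ ((S - T) *ᵥ (v j).ofLp)| ≤ Δ) :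
    |contractedHessian β A B w v S - contractedHessian β A B w v T| ≤ 3 * D * Δ * β ^ 2 := by
  have e : contractedHessian β A B w v S - contractedHessian β A B w v T =
      contractedHessian β A B w v (S - T) := by
    simp only [contractedHessian, Matrix.sub_mulVec, dotProduct_sub, mul_sub,
      Finset.sum_sub_distrib]
    ring
  have hne : Nonempty ι := by
    by_contra h
    rw [not_nonempty_iff] at h
    simp at hw1
  have hΔ0 : 0 ≤ Δ := (abs_nonneg _).trans (hΔ hne.some hne.some)
  have h1 : |∑ i, ∑ j, w i * w j * ((v i).ofLp ⬝ᵥ ((S - T) *ᵥ (v j).ofLp))| ≤ Δ := by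
    calc _ ≤ ∑ i, ∑ j, w i * w j * Δ := by
          refine (Finset.abs_sum_le_sum_abs _ _).trans (Finset.sum_le_sum fun i _ =>
            (Finset.abs_sum_le_sum_abs _ _).trans (Finset.sum_le_sum fun j _ => ?_))
          rw [abs_mul, abs_of_nonneg (mul_nonneg (hw i) (hw j))]
          exact mul_le_mul_of_nonneg_left (hΔ i j) (mul_nonneg (hw i) (hw j))
      _ = Δ := by
          simp_rw [← Finset.sum_mul, ← Finset.mul_sum, hw1, mul_one, hw1, one_mul]
  have h2 : |∑ i, w i * ((v i).ofLp ⬝ᵥ ((S - T) *ᵥ (v i).ofLp))| ≤ Δ := by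
    calc _ ≤ ∑ i, w i * Δ := by
          refine (Finset.abs_sum_le_sum_abs _ _).trans (Finset.sum_le_sum fun i _ => ?_)
          rw [abs_mul, abs_of_nonneg (hw i)]
          exact mul_le_mul_of_nonneg_left (hΔ i i) (hw i)
      _ = Δ := by rw [← Finset.sum_mul, hw1, one_mul]
  rw [e, contractedHessian, abs_mul, abs_of_nonneg (sq_nonneg β), mul_comm (3 * D * Δ)]
  refine mul_le_mul_of_nonneg_left ?_ (sq_nonneg β)
  have hBA : |B - A| ≤ 2 * D := (abs_sub _ _).trans (by linarith)
  have hD : 0 ≤ D := (abs_nonneg _).trans hA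
  refine (abs_add_le _ _).trans ?_
  rw [abs_mul, abs_mul]
  have := mul_le_mul hBA h1 (abs_nonneg _) (by positivity)
  have := mul_le_mul hA h2 (abs_nonneg _) hD
  linarith

/-- Second order expansion of `∫ f(x + y) N(0, S)(dy)` for `f = smoothInd`. -/
lemma abs_integral_smoothInd_sub_le [Nonempty ι] {R D : ℝ} (hR : ∀ i, ‖v i‖ ≤ R)
    {t t1 t2 t3 : ℝ → ℝ} (h0 : ∀ x, HasDerivAt t (t1 x) x) (h1 : ∀ x, HasDerivAt t1 (t2 x) x)
    (h2 : ∀ x, HasDerivAt t2 (t3 x) x) (b1 : ∀ x, |t1 x| ≤ D) (b2 : ∀ x, |t2 x| ≤ D)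
    (b3 : ∀ x, |t3 x| ≤ D) (bt : ∀ x, |t x| ≤ 1)
    {S : Matrix (Fin p) (Fin p) ℝ} (hS : S.PosSemidef) (x : RVec p) :
    |∫ y, smoothInd t β v b (x + y) ∂(multivariateGaussian 0 S) - smoothInd t β v b x -
      contractedHessian β (t1 (Real.log (∑ i, Real.exp (β * (inner ℝ x (v i) - b i)))))
        (t2 (Real.log (∑ i, Real.exp (β * (inner ℝ x (v i) - b i)))))
        (softWeight β v b x) v S / 2| ≤
      13 * D * (|β| * R) ^ 3 * ∫ y, ‖y‖ ^ 3 ∂(multivariateGaussian 0 S) := by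
  set μ : Measure (RVec p) := multivariateGaussian 0 S with hμ
  set A := t1 (Real.log (∑ i, Real.exp (β * (inner ℝ x (v i) - b i)))) with hA
  set B := t2 (Real.log (∑ i, Real.exp (β * (inner ℝ x (v i) - b i)))) with hB
  set w := softWeight β v b x with hw
  have htc : Continuous t := continuous_iff_continuousAt.2 fun x => (h0 x).continuousAt
  have i0 : Integrable (fun y => smoothInd t β v b (x + y)) μ :=
    (integrable_const (1 : ℝ)).mono'
      (((continuous_smoothInd htc).comp (continuous_const_add x)).aestronglyMeasurable)
      (Filter.Eventually.of_forall fun y => bt _)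
  have il : ∀ u : RVec p, Integrable (fun y => inner ℝ y u) μ := fun u =>
    (memLp_inner_multivariateGaussian u).integrable (by norm_num)
  have iq : ∀ u u' : RVec p, Integrable (fun y => inner ℝ y u * inner ℝ y u') μ := fun u u' =>
    (memLp_inner_multivariateGaussian u).integrable_mul (memLp_inner_multivariateGaussian u')
  -- On the segment from x to x + y the function is t of an `expSum` with coefficients exp(β(⟨x, vᵢ⟩
  -- − bᵢ)) and rates β⟨y, vᵢ⟩. The tilted moments at the starting point are soft-max averages at x,
  -- so they are linear and quadratic in y.
  have m1 : ∀ y : RVec p, tiltMoment (fun i => Real.exp (β * (inner ℝ x (v i) - b i)))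
      (fun i => β * inner ℝ y (v i)) 1 0 = ∑ i, β * w i * inner ℝ y (v i) := fun y => by
    simp only [tiltMoment, expSum, zero_mul, Real.exp_zero, mul_one, pow_one, pow_zero, hw,
      softWeight, Finset.sum_div]
    exact Finset.sum_congr rfl fun i _ => by ring
  have m2 : ∀ y : RVec p, tiltMoment (fun i => Real.exp (β * (inner ℝ x (v i) - b i)))
      (fun i => β * inner ℝ y (v i)) 2 0 =
        ∑ i, β ^ 2 * w i * (inner ℝ y (v i) * inner ℝ y (v i)) := fun y => by
    simp only [tiltMoment, expSum, zero_mul, Real.exp_zero, mul_one, pow_zero, hw,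
      softWeight, Finset.sum_div]
    exact Finset.sum_congr rfl fun i _ => by ring
  have e0 : ∀ y : RVec p, expSum (fun i => Real.exp (β * (inner ℝ x (v i) - b i)))
      (fun i => β * inner ℝ y (v i)) 0 0 = ∑ i, Real.exp (β * (inner ℝ x (v i) - b i)) :=
    fun y => by simp [expSum]
  have e1 : ∀ y : RVec p, expSum (fun i => Real.exp (β * (inner ℝ x (v i) - b i)))
      (fun i => β * inner ℝ y (v i)) 0 1 = ∑ i, Real.exp (β * (inner ℝ (x + y) (v i) - b i)) :=
    fun y => by
      simp only [expSum, pow_zero, mul_one, one_mul, ← Real.exp_add, inner_add_left]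
      exact Finset.sum_congr rfl fun i _ => by ring_nf
  have hpt : ∀ y : RVec p, |smoothInd t β v b (x + y) - smoothInd t β v b x -
      ∑ i, A * β * w i * inner ℝ y (v i) -
      ((∑ i, ∑ j, (B - A) * β ^ 2 * w i * w j * (inner ℝ y (v i) * inner ℝ y (v j))) +
        ∑ i, A * β ^ 2 * w i * (inner ℝ y (v i) * inner ℝ y (v i))) / 2| ≤
      13 * D * (|β| * R) ^ 3 * ‖y‖ ^ 3 := fun y => by
    have hM : ∀ i, |β * inner ℝ y (v i)| ≤ |β| * R * ‖y‖ := fun i => by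
      rw [abs_mul, mul_assoc]
      refine mul_le_mul_of_nonneg_left ?_ (abs_nonneg _)
      refine (abs_real_inner_le_norm _ _).trans ?_
      rw [mul_comm]
      exact mul_le_mul_of_nonneg_right (hR i) (norm_nonneg _)
    have key := abs_log_expSum_taylor_le
      (a := fun i => Real.exp (β * (inner ℝ x (v i) - b i))) (fun i => Real.exp_pos _) hM
      h0 h1 h2 b1 b2 b3
    rw [e0, e1, m1, m2, ← hA, ← hB] at key
    have c1 : ∑ i, A * β * w i * inner ℝ y (v i) = A * ∑ i, β * w i * inner ℝ y (v i) := by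
      rw [Finset.mul_sum]
      exact Finset.sum_congr rfl fun i _ => by ring
    have c2 : ∑ i, ∑ j, (B - A) * β ^ 2 * w i * w j * (inner ℝ y (v i) * inner ℝ y (v j)) =
        (B - A) * (∑ i, β * w i * inner ℝ y (v i)) ^ 2 := by
      rw [sq (∑ i, β * w i * inner ℝ y (v i)), Finset.sum_mul_sum, Finset.mul_sum]
      refine Finset.sum_congr rfl fun i _ => ?_
      rw [Finset.mul_sum]
      exact Finset.sum_congr rfl fun j _ => by ring
    have c3 : ∑ i, A * β ^ 2 * w i * (inner ℝ y (v i) * inner ℝ y (v i)) =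
        A * ∑ i, β ^ 2 * w i * (inner ℝ y (v i) * inner ℝ y (v i)) := by
      rw [Finset.mul_sum]
      exact Finset.sum_congr rfl fun i _ => by ring
    rw [c1, c2, c3]
    refine le_trans (le_of_eq ?_) (key.trans (le_of_eq ?_))
    · unfold smoothInd
      congr 1
      ring
    · ring
  have il' : Integrable (fun y => ∑ i, A * β * w i * inner ℝ y (v i)) μ :=
    integrable_finsetSum _ fun i _ => (il _).const_mul _
  have iq1 : Integrable (fun y => ∑ i, ∑ j, (B - A) * β ^ 2 * w i * w j *
      (inner ℝ y (v i) * inner ℝ y (v j))) μ :=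
    integrable_finsetSum _ fun i _ => integrable_finsetSum _ fun j _ => (iq _ _).const_mul _
  have iq2 : Integrable (fun y => ∑ i, A * β ^ 2 * w i *
      (inner ℝ y (v i) * inner ℝ y (v i))) μ :=
    integrable_finsetSum _ fun i _ => (iq _ _).const_mul _
  have hI := norm_integral_le_of_norm_le
    ((integrable_norm_pow_multivariateGaussian (S := S) 3).const_mul (13 * D * (|β| * R) ^ 3))
    (Filter.Eventually.of_forall fun y => (Real.norm_eq_abs _).trans_le (hpt y))
  rw [integral_const_mul] at hI
  refine le_trans (le_of_eq ?_) hI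
  rw [Real.norm_eq_abs]
  congr 1
  -- Integration kills the linear term by centring and turns the quadratic terms into contractions
  -- with S.
  have l0 : ∫ y, ∑ i, A * β * w i * inner ℝ y (v i) ∂μ = 0 := by
    rw [integral_finsetSum _ fun i _ => (il _).const_mul _]
    refine Finset.sum_eq_zero fun i _ => ?_
    rw [integral_const_mul, integral_inner_multivariateGaussian, mul_zero]
  have l1 : ∫ y, ∑ i, ∑ j, (B - A) * β ^ 2 * w i * w j *
      (inner ℝ y (v i) * inner ℝ y (v j)) ∂μ =
      ∑ i, ∑ j, (B - A) * β ^ 2 * w i * w j * ((v i).ofLp ⬝ᵥ (S *ᵥ (v j).ofLp)) := by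
    rw [integral_finsetSum _ fun i _ => integrable_finsetSum _ fun j _ => (iq _ _).const_mul _]
    refine Finset.sum_congr rfl fun i _ => ?_
    rw [integral_finsetSum _ fun j _ => (iq _ _).const_mul _]
    refine Finset.sum_congr rfl fun j _ => ?_
    rw [integral_const_mul, integral_inner_mul_inner_multivariateGaussian hS]
  have l2 : ∫ y, ∑ i, A * β ^ 2 * w i * (inner ℝ y (v i) * inner ℝ y (v i)) ∂μ =
      ∑ i, A * β ^ 2 * w i * ((v i).ofLp ⬝ᵥ (S *ᵥ (v i).ofLp)) := by
    rw [integral_finsetSum _ fun i _ => (iq _ _).const_mul _]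
    refine Finset.sum_congr rfl fun i _ => ?_
    rw [integral_const_mul, integral_inner_mul_inner_multivariateGaussian hS]
  have j1 : Integrable (fun y => smoothInd t β v b (x + y) - smoothInd t β v b x) μ :=
    i0.sub (integrable_const _)
  have j2 : Integrable (fun y => smoothInd t β v b (x + y) - smoothInd t β v b x -
      ∑ i, A * β * w i * inner ℝ y (v i)) μ := j1.sub il'
  have j3 : Integrable (fun y => ((∑ i, ∑ j, (B - A) * β ^ 2 * w i * w j *
      (inner ℝ y (v i) * inner ℝ y (v j))) +
      ∑ i, A * β ^ 2 * w i * (inner ℝ y (v i) * inner ℝ y (v i))) / 2) μ :=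
    (iq1.add iq2).div_const 2
  rw [integral_sub j2 j3, integral_sub j1 il', integral_sub i0 (integrable_const _), l0,
    integral_div, integral_add iq1 iq2, l1, l2]
  simp only [integral_const, probReal_univ, one_smul, contractedHessian]
  have c2 : ∑ i, ∑ j, (B - A) * β ^ 2 * w i * w j * ((v i).ofLp ⬝ᵥ (S *ᵥ (v j).ofLp)) =
      β ^ 2 * ((B - A) * ∑ i, ∑ j, w i * w j * ((v i).ofLp ⬝ᵥ (S *ᵥ (v j).ofLp))) := by
    simp_rw [Finset.mul_sum]
    exact Finset.sum_congr rfl fun i _ => Finset.sum_congr rfl fun j _ => by ring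
  have c3 : ∑ i, A * β ^ 2 * w i * ((v i).ofLp ⬝ᵥ (S *ᵥ (v i).ofLp)) =
      β ^ 2 * (A * ∑ i, w i * ((v i).ofLp ⬝ᵥ (S *ᵥ (v i).ofLp))) := by
    simp_rw [Finset.mul_sum]
    exact Finset.sum_congr rfl fun i _ => by ring
  rw [c2, c3]
  ring

/-- One swap in the Lindeberg argument, with everything not being swapped placed in μ. Two separate
derivative bounds are carried. A controls the second-order term and survives to the end, whereas D
enters only the third-moment remainder, which disappears in the limit. -/
lemma abs_integral_conv_smoothInd_sub_le [Nonempty ι] {R D A Δ : ℝ} (hR : ∀ i, ‖v i‖ ≤ R)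
    {t t1 t2 t3 : ℝ → ℝ} (h0 : ∀ x, HasDerivAt t (t1 x) x) (h1 : ∀ x, HasDerivAt t1 (t2 x) x)
    (h2 : ∀ x, HasDerivAt t2 (t3 x) x) (b1 : ∀ x, |t1 x| ≤ D) (b2 : ∀ x, |t2 x| ≤ D)
    (b3 : ∀ x, |t3 x| ≤ D) (bt : ∀ x, |t x| ≤ 1) (A1 : ∀ x, |t1 x| ≤ A) (A2 : ∀ x, |t2 x| ≤ A)
    {S T : Matrix (Fin p) (Fin p) ℝ} (hS : S.PosSemidef) (hT : T.PosSemidef)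
    (hΔ : ∀ i j, |(v i).ofLp ⬝ᵥ ((S - T) *ᵥ (v j).ofLp)| ≤ Δ)
    (μ : Measure (RVec p)) [IsProbabilityMeasure μ] :
    |∫ y, smoothInd t β v b y ∂(μ ∗ multivariateGaussian 0 S) -
      ∫ y, smoothInd t β v b y ∂(μ ∗ multivariateGaussian 0 T)| ≤
      3 / 2 * A * Δ * β ^ 2 + 13 * D * (|β| * R) ^ 3 *
        (∫ y, ‖y‖ ^ 3 ∂(multivariateGaussian 0 S : Measure (RVec p)) +
          ∫ y, ‖y‖ ^ 3 ∂(multivariateGaussian 0 T : Measure (RVec p))) := by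
  have htc : Continuous t := continuous_iff_continuousAt.2 fun x => (h0 x).continuousAt
  have hf : Continuous (smoothInd t β v b) := continuous_smoothInd htc
  have hi : ∀ ν : Measure (RVec p), IsFiniteMeasure ν → Integrable (smoothInd t β v b) ν :=
    fun ν _ => (integrable_const (1 : ℝ)).mono' hf.aestronglyMeasurable
      (Filter.Eventually.of_forall fun y => bt _)
  have hi2 : ∀ U : Matrix (Fin p) (Fin p) ℝ,
      Integrable (fun x => ∫ y, smoothInd t β v b (x + y) ∂(multivariateGaussian 0 U)) μ :=
    fun U => by
      have := (hi (μ ∗ multivariateGaussian 0 U) inferInstance)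
      rw [Measure.conv, integrable_map_measure hf.aestronglyMeasurable (by fun_prop)] at this
      exact this.integral_prod_left
  rw [integral_conv (hi _ inferInstance), integral_conv (hi _ inferInstance),
    ← integral_sub (hi2 S) (hi2 T)]
  have hpt : ∀ x : RVec p, ‖∫ y, smoothInd t β v b (x + y) ∂(multivariateGaussian 0 S) -
      ∫ y, smoothInd t β v b (x + y) ∂(multivariateGaussian 0 T)‖ ≤
      3 / 2 * A * Δ * β ^ 2 + 13 * D * (|β| * R) ^ 3 *
        (∫ y, ‖y‖ ^ 3 ∂(multivariateGaussian 0 S : Measure (RVec p)) +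
          ∫ y, ‖y‖ ^ 3 ∂(multivariateGaussian 0 T : Measure (RVec p))) := fun x => by
    have eS := abs_integral_smoothInd_sub_le (β := β) (b := b) hR h0 h1 h2 b1 b2 b3 bt hS x
    have eT := abs_integral_smoothInd_sub_le (β := β) (b := b) hR h0 h1 h2 b1 b2 b3 bt hT x
    have eH := abs_contractedHessian_sub_le (β := β) (v := v)
      (softWeight_nonneg (β := β) (v := v) (b := b) x)
      (sum_softWeight x) (A1 (Real.log (∑ i, Real.exp (β * (inner ℝ x (v i) - b i)))))
      (A2 (Real.log (∑ i, Real.exp (β * (inner ℝ x (v i) - b i))))) hΔ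
    rw [Real.norm_eq_abs]
    rw [abs_le] at *
    constructor <;> linarith [eS.1, eS.2, eT.1, eT.2, eH.1, eH.2]
  have := norm_integral_le_of_norm_le_const (μ := μ) (Filter.Eventually.of_forall hpt)
  simpa using this

lemma integral_norm_pow_multivariateGaussian_smul {S : Matrix (Fin p) (Fin p) ℝ}
    (hS : S.PosSemidef) {r : ℝ} (hr : 0 ≤ r) (k : ℕ) :
    ∫ y, ‖y‖ ^ k ∂(multivariateGaussian 0 (r ^ 2 • S) : Measure (RVec p)) =
      r ^ k * ∫ y, ‖y‖ ^ k ∂(multivariateGaussian 0 S : Measure (RVec p)) := by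
  rw [multivariateGaussian_smul hS, integral_map (by fun_prop) (by fun_prop),
    ← integral_const_mul]
  refine integral_congr_ae (Filter.Eventually.of_forall fun y => ?_)
  simp only [norm_smul, mul_pow, Real.norm_eq_abs, abs_of_nonneg hr]

/-- Lindeberg interpolation between two centred Gaussian measures. -/
theorem abs_integral_smoothInd_multivariateGaussian_sub_le [Nonempty ι] {D A Δ : ℝ}
    {t t1 t2 t3 : ℝ → ℝ} (h0 : ∀ x, HasDerivAt t (t1 x) x) (h1 : ∀ x, HasDerivAt t1 (t2 x) x)
    (h2 : ∀ x, HasDerivAt t2 (t3 x) x) (b1 : ∀ x, |t1 x| ≤ D) (b2 : ∀ x, |t2 x| ≤ D)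
    (b3 : ∀ x, |t3 x| ≤ D) (bt : ∀ x, |t x| ≤ 1) (A1 : ∀ x, |t1 x| ≤ A) (A2 : ∀ x, |t2 x| ≤ A)
    {S T : Matrix (Fin p) (Fin p) ℝ} (hS : S.PosSemidef) (hT : T.PosSemidef)
    (hΔ : ∀ i j, |(v i).ofLp ⬝ᵥ ((S - T) *ᵥ (v j).ofLp)| ≤ Δ) :
    |∫ y, smoothInd t β v b y ∂(multivariateGaussian 0 S) -
      ∫ y, smoothInd t β v b y ∂(multivariateGaussian 0 T)| ≤ 3 / 2 * A * Δ * β ^ 2 := by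
  obtain ⟨R, hR⟩ : ∃ R, ∀ i, ‖v i‖ ≤ R :=
    ⟨∑ i, ‖v i‖, fun i => Finset.single_le_sum (f := fun i => ‖v i‖)
      (fun _ _ => norm_nonneg _) (Finset.mem_univ i)⟩
  set E : ℝ := 13 * D * (|β| * R) ^ 3 *
    (∫ y, ‖y‖ ^ 3 ∂(multivariateGaussian 0 S : Measure (RVec p)) +
      ∫ y, ‖y‖ ^ 3 ∂(multivariateGaussian 0 T : Measure (RVec p))) with hE
  -- Split each Gaussian into m independent pieces of covariance S/m or T/m and exchange them one at
  -- a time. A swap costs the m-th part of the main term plus a remainder of order m^(−3/2), so the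
  -- remainders sum to order m^(−1/2).
  have main : ∀ m : ℕ, 0 < m → |∫ y, smoothInd t β v b y ∂(multivariateGaussian 0 S) -
      ∫ y, smoothInd t β v b y ∂(multivariateGaussian 0 T)| ≤
      3 / 2 * A * Δ * β ^ 2 + E * (Real.sqrt m)⁻¹ := by
    intro m hm
    set r : ℝ := (Real.sqrt m)⁻¹ with hr
    have hm' : (0 : ℝ) < m := by exact_mod_cast hm
    have hr0 : 0 ≤ r := by positivity
    have hr2 : (m : ℝ) * r ^ 2 = 1 := by
      rw [hr, inv_pow, Real.sq_sqrt hm'.le, mul_inv_cancel₀ hm'.ne']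
    set a : ℕ → ℝ := fun k => ∫ y, smoothInd t β v b y
      ∂(multivariateGaussian 0 ((k * r ^ 2) • S + ((m - k) * r ^ 2) • T)) with ha
    have ham : a m = ∫ y, smoothInd t β v b y ∂(multivariateGaussian 0 S) := by
      simp [ha, hr2]
    have ha0 : a 0 = ∫ y, smoothInd t β v b y ∂(multivariateGaussian 0 T) := by
      simp [ha, hr2]
    have step : ∀ k ∈ Finset.range m, |a (k + 1) - a k| ≤
        3 / 2 * A * (r ^ 2 * Δ) * β ^ 2 + E * r ^ 3 := by
      intro k hk
      have hk : (k : ℝ) + 1 ≤ m := by exact_mod_cast Finset.mem_range.1 hk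
      have hW : ((k * r ^ 2) • S + ((m - k - 1) * r ^ 2) • T).PosSemidef :=
        (hS.smul (by positivity)).add (hT.smul (mul_nonneg (by linarith) (sq_nonneg r)))
      have hSr : (r ^ 2 • S).PosSemidef := hS.smul (sq_nonneg r)
      have hTr : (r ^ 2 • T).PosSemidef := hT.smul (sq_nonneg r)
      have e1 : (((k + 1 : ℕ) : ℝ) * r ^ 2) • S + ((m - (k + 1 : ℕ)) * r ^ 2) • T =
          ((k * r ^ 2) • S + ((m - k - 1) * r ^ 2) • T) + r ^ 2 • S := by
        push_cast
        module
      have e2 : ((k : ℝ) * r ^ 2) • S + ((m - k) * r ^ 2) • T =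
          ((k * r ^ 2) • S + ((m - k - 1) * r ^ 2) • T) + r ^ 2 • T := by
        module
      have hΔ' : ∀ i j, |(v i).ofLp ⬝ᵥ ((r ^ 2 • S - r ^ 2 • T) *ᵥ (v j).ofLp)| ≤ r ^ 2 * Δ :=
        fun i j => by
          rw [← smul_sub, Matrix.smul_mulVec, dotProduct_smul, smul_eq_mul, abs_mul,
            abs_of_nonneg (sq_nonneg r)]
          exact mul_le_mul_of_nonneg_left (hΔ i j) (sq_nonneg r)
      have := abs_integral_conv_smoothInd_sub_le (β := β) (b := b) hR h0 h1 h2 b1 b2 b3 bt A1 A2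
        hSr hTr hΔ' (multivariateGaussian 0 ((k * r ^ 2) • S + ((m - k - 1) * r ^ 2) • T))
      rw [multivariateGaussian_conv hW hSr, multivariateGaussian_conv hW hTr, ← e1, ← e2,
        integral_norm_pow_multivariateGaussian_smul hS hr0,
        integral_norm_pow_multivariateGaussian_smul hT hr0] at this
      refine this.trans (le_of_eq ?_)
      rw [hE]
      ring
    rw [← ham, ← ha0, ← Finset.sum_range_sub]
    refine (Finset.abs_sum_le_sum_abs _ _).trans ((Finset.sum_le_sum step).trans (le_of_eq ?_))
    rw [Finset.sum_const, Finset.card_range, nsmul_eq_mul]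
    linear_combination (3 / 2 * A * Δ * β ^ 2 + E * r) * hr2
  have hlim : Filter.Tendsto (fun m : ℕ => 3 / 2 * A * Δ * β ^ 2 + E * (Real.sqrt m)⁻¹)
      Filter.atTop (nhds (3 / 2 * A * Δ * β ^ 2 + E * 0)) :=
    ((tendsto_inv_atTop_zero.comp (Real.tendsto_sqrt_atTop.comp
      tendsto_natCast_atTop_atTop)).const_mul E).const_add _
  rw [mul_zero, add_zero] at hlim
  exact ge_of_tendsto hlim ((Filter.eventually_gt_atTop 0).mono main)

end Comparison

/-! ### Gaussian anti-concentration (Nazarov's inequality) -/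

section AntiConcentration

variable {p : ℕ} {S : Matrix (Fin p) (Fin p) ℝ}

lemma inner_eq_dotProduct (x y : RVec p) : inner ℝ x y = x.ofLp ⬝ᵥ y.ofLp := by
  rw [EuclideanSpace.inner_eq_star_dotProduct, star_trivial, dotProduct_comm]

lemma dotProduct_mulVec_symm (hS : S.PosSemidef) (x y : Fin p → ℝ) :
    x ⬝ᵥ (S *ᵥ y) = y ⬝ᵥ (S *ᵥ x) := by
  have h : Sᵀ = S := by simpa [Matrix.IsHermitian] using hS.isHermitian
  rw [dotProduct_mulVec, ← mulVec_transpose, h, dotProduct_comm]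

lemma posSemidef_dotProduct_nonneg (hS : S.PosSemidef) (x : Fin p → ℝ) : 0 ≤ x ⬝ᵥ (S *ᵥ x) := by
  simpa using hS.dotProduct_mulVec_nonneg x

lemma dotProduct_vecMulVec_self (c x y : Fin p → ℝ) :
    x ⬝ᵥ (vecMulVec c c *ᵥ y) = (c ⬝ᵥ x) * (c ⬝ᵥ y) := by
  rw [vecMulVec_mulVec, dotProduct_smul, dotProduct_comm x c]
  simp

lemma posSemidef_vecMulVec (c : Fin p → ℝ) : (vecMulVec c c).PosSemidef := by
  simpa using posSemidef_vecMulVec_self_star c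

/-- The covariance matrix of the residual after regressing on `⟨·, u⟩`. -/
lemma posSemidef_sub_vecMulVec (hS : S.PosSemidef) {u : Fin p → ℝ} (hu : u ⬝ᵥ (S *ᵥ u) = 1) :
    (S - vecMulVec (S *ᵥ u) (S *ᵥ u)).PosSemidef := by
  refine PosSemidef.of_dotProduct_mulVec_nonneg
    (hS.isHermitian.sub (posSemidef_vecMulVec _).isHermitian) fun x => ?_
  rw [star_trivial, sub_mulVec, dotProduct_sub, dotProduct_vecMulVec_self]
  set r := (S *ᵥ u) ⬝ᵥ x with hr
  have h := posSemidef_dotProduct_nonneg hS (x - r • u)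
  have e1 : x ⬝ᵥ (S *ᵥ u) = r := dotProduct_comm _ _
  have e2 : u ⬝ᵥ (S *ᵥ x) = r := by rw [dotProduct_mulVec_symm hS, e1]
  simp only [mulVec_sub, mulVec_smul, dotProduct_sub, sub_dotProduct, dotProduct_smul,
    smul_dotProduct, e1, e2, hu, smul_eq_mul] at h
  linarith

lemma map_smul_gaussianReal (c : RVec p) :
    (gaussianReal 0 1).map (fun z : ℝ => z • c) =
      multivariateGaussian 0 (vecMulVec c.ofLp c.ofLp) := by
  apply Measure.ext_of_charFun
  ext x
  have h : charFun ((gaussianReal 0 1).map (fun z : ℝ => z • c)) x =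
      charFun (gaussianReal 0 1) (inner ℝ c x) := by
    rw [charFun_apply, charFun_apply, integral_map (by fun_prop) (by fun_prop)]
    simp [real_inner_smul_left, mul_comm]
  rw [h, charFun_gaussianReal, charFun_multivariateGaussian (posSemidef_vecMulVec _),
    dotProduct_vecMulVec_self, inner_eq_dotProduct]
  simp
  ring_nf

/-- The density ratio φ(z)/φ(z + h) equals exp(hz + h²/2), which is at most exp(hT + h²/2) on A. -/
lemma gaussianReal_le_shift {A : Set ℝ} (hA : MeasurableSet A) {T h : ℝ} (hT : ∀ z ∈ A, z ≤ T)
    (hh : 0 ≤ h) : gaussianReal 0 1 A ≤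
      ENNReal.ofReal (Real.exp (h * T + h ^ 2 / 2)) * gaussianReal 0 1 {z | z - h ∈ A} := by
  have e : gaussianReal 0 1 {z | z - h ∈ A} = gaussianReal (-h) 1 A := by
    have := gaussianReal_map_sub_const (μ := 0) (v := 1) h
    rw [zero_sub] at this
    rw [← this, Measure.map_apply (by fun_prop) hA]
    rfl
  rw [e, gaussianReal_apply _ one_ne_zero, gaussianReal_apply _ one_ne_zero,
    ← lintegral_const_mul _ (by fun_prop)]
  refine setLIntegral_mono' hA fun z hz => ?_
  rw [gaussianPDF, gaussianPDF, ← ENNReal.ofReal_mul (Real.exp_pos _).le]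
  refine ENNReal.ofReal_le_ofReal ?_
  rw [gaussianPDFReal_def, gaussianPDFReal_def, mul_left_comm, ← Real.exp_add]
  refine mul_le_mul_of_nonneg_left (Real.exp_le_exp.2 ?_) (by positivity)
  have := mul_le_mul_of_nonneg_left (hT z hz) hh
  simp only [NNReal.coe_one]
  nlinarith

/-- Quasi-invariance of a centred Gaussian measure under shifts along `S u`. -/
lemma multivariateGaussian_le_shift (hS : S.PosSemidef) {u : RVec p}
    (hu : u.ofLp ⬝ᵥ (S *ᵥ u.ofLp) = 1) {E F : Set (RVec p)} (hE : MeasurableSet E)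
    (hF : MeasurableSet F) {T h : ℝ} (hh : 0 ≤ h) (hT : ∀ x ∈ E, inner ℝ x u ≤ T)
    (hEF : ∀ x ∈ E, x + h • WithLp.toLp 2 (S *ᵥ u.ofLp) ∈ F) :
    multivariateGaussian 0 S E ≤
      ENNReal.ofReal (Real.exp (h * T + h ^ 2 / 2)) * multivariateGaussian 0 S F := by
  set c : RVec p := WithLp.toLp 2 (S *ᵥ u.ofLp) with hc
  set Q := S - vecMulVec c.ofLp c.ofLp with hQ
  have hQp : Q.PosSemidef := posSemidef_sub_vecMulVec hS hu
  have hcu : inner ℝ c u = 1 := by rw [inner_eq_dotProduct, dotProduct_comm]; exact hu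
  -- Regression on ⟨·, u⟩: a standard normal multiple of c = S u plus an independent residual of
  -- covariance Q. A shift along c moves only the scalar component.
  have hdec : (multivariateGaussian 0 S : Measure (RVec p)) =
      ((gaussianReal 0 1).map (fun z : ℝ => z • c)) ∗ multivariateGaussian 0 Q := by
    rw [map_smul_gaussianReal, multivariateGaussian_conv (posSemidef_vecMulVec _) hQp, hQ,
      add_sub_cancel]
  have happ : ∀ {G : Set (RVec p)}, MeasurableSet G → multivariateGaussian 0 S G =
      ∫⁻ r, gaussianReal 0 1 {z : ℝ | z • c + r ∈ G} ∂(multivariateGaussian 0 Q) := by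
    intro G hG
    have hm : Measurable fun x : RVec p × RVec p => x.1 + x.2 := by fun_prop
    rw [hdec, Measure.conv, Measure.map_apply hm hG, Measure.prod_apply_symm (hm hG)]
    refine lintegral_congr fun r => ?_
    rw [Measure.map_apply (by fun_prop) (measurable_prodMk_right (hm hG))]
    rfl
  -- The residual has variance 1 − 1 = 0 in direction u, so ⟨z c + r, u⟩ = z almost surely and the
  -- bound T applies to z itself.
  have hres : ∀ᵐ r ∂(multivariateGaussian 0 Q : Measure (RVec p)), inner ℝ r u = 0 := by
    have hm := map_inner_multivariateGaussian hQp u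
    have h0 : u.ofLp ⬝ᵥ (Q *ᵥ u.ofLp) = 0 := by
      rw [hQ, sub_mulVec, dotProduct_sub, dotProduct_vecMulVec_self, hu, ← inner_eq_dotProduct,
        hcu]
      norm_num
    rw [h0, Real.toNNReal_zero, gaussianReal_zero_var] at hm
    have : ∀ᵐ y ∂((multivariateGaussian 0 Q : Measure (RVec p)).map fun y => inner ℝ y u),
        y = 0 := by
      rw [hm]
      simp [ae_dirac_eq]
    exact ae_of_ae_map (by fun_prop) this
  rw [happ hE, happ hF, ← lintegral_const_mul' _ _ ENNReal.ofReal_ne_top]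
  refine lintegral_mono_ae (hres.mono fun r hr => ?_)
  have hmeas : Measurable fun z : ℝ => z • c + r := by fun_prop
  refine (gaussianReal_le_shift (hmeas hE) (T := T) (h := h) (fun z hz => ?_) hh).trans ?_
  · have := hT _ hz
    rwa [inner_add_left, real_inner_smul_left, hcu, hr, mul_one, add_zero] at this
  · refine mul_le_mul' le_rfl (measure_mono fun z hz => ?_)
    have := hEF _ hz
    have e : (z - h) • c + r + h • c = z • c + r := by module
    rw [e] at this
    exact this

/-- A correlation is at most 1: expand the nonnegative quadratic form at u − w. Only the upper bound
is needed for the shift argument. -/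
lemma abs_dotProduct_mulVec_le_one (hS : S.PosSemidef) {u w : Fin p → ℝ}
    (hu : u ⬝ᵥ (S *ᵥ u) = 1) (hw : w ⬝ᵥ (S *ᵥ w) = 1) : (S *ᵥ u) ⬝ᵥ w ≤ 1 := by
  have h := posSemidef_dotProduct_nonneg hS (u - w)
  have e := dotProduct_mulVec_symm hS u w
  simp only [mulVec_sub, dotProduct_sub, sub_dotProduct, hu, hw] at h
  rw [dotProduct_comm]
  linarith

variable {ι : Type*} [Fintype ι]

/-- The event that the maximum of `⟨x, uⱼ⟩ - βⱼ` lies in `(lo, hi]`. -/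
def maxSlab (u : ι → RVec p) (β : ι → ℝ) (lo hi : ℝ) : Set (RVec p) :=
  {x | (∀ j, inner ℝ x (u j) - β j ≤ hi) ∧ ∃ j, lo < inner ℝ x (u j) - β j}

lemma measurableSet_maxSlab (u : ι → RVec p) (β : ι → ℝ) (lo hi : ℝ) :
    MeasurableSet (maxSlab u β lo hi) := by
  have h1 : MeasurableSet {x : RVec p | ∀ j, inner ℝ x (u j) - β j ≤ hi} := by
    rw [Set.ofPred_forall]
    exact MeasurableSet.iInter fun j => measurableSet_le (by fun_prop) measurable_const
  have h2 : MeasurableSet {x : RVec p | ∃ j, lo < inner ℝ x (u j) - β j} := by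
    rw [Set.ofPred_exists]
    exact MeasurableSet.iUnion fun j => measurableSet_lt measurable_const (by fun_prop)
  exact h1.inter h2

/-- The event that the maximum lies in `(lo, hi]` and is first attained at `j`. -/
def maxSlabAt (f : ι → ℕ) (u : ι → RVec p) (β : ι → ℝ) (lo hi : ℝ) (j : ι) : Set (RVec p) :=
  {x | lo < inner ℝ x (u j) - β j ∧ inner ℝ x (u j) - β j ≤ hi ∧
    (∀ i, inner ℝ x (u i) - β i ≤ inner ℝ x (u j) - β j) ∧
    ∀ i, f i < f j → inner ℝ x (u i) - β i < inner ℝ x (u j) - β j}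

lemma measurableSet_maxSlabAt (f : ι → ℕ) (u : ι → RVec p) (β : ι → ℝ) (lo hi : ℝ) (j : ι) :
    MeasurableSet (maxSlabAt f u β lo hi j) := by
  have hm : ∀ i, Measurable fun x : RVec p => inner ℝ x (u i) - β i := fun i => by fun_prop
  refine (measurableSet_lt measurable_const (hm j)).inter
    ((measurableSet_le (hm j) measurable_const).inter (MeasurableSet.inter ?_ ?_))
  · change MeasurableSet {x : RVec p | ∀ i, _}
    rw [Set.ofPred_forall]
    exact MeasurableSet.iInter fun i => measurableSet_le (by fun_prop) (by fun_prop)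
  · change MeasurableSet {x : RVec p | ∀ i, _}
    simp_rw [Set.ofPred_forall]
    exact MeasurableSet.iInter fun i => MeasurableSet.iInter fun _ =>
      measurableSet_lt (by fun_prop) (by fun_prop)

lemma iUnion_maxSlabAt (f : ι → ℕ) (u : ι → RVec p) (β : ι → ℝ) (lo hi : ℝ) :
    ⋃ j, maxSlabAt f u β lo hi j = maxSlab u β lo hi := by
  ext x
  simp only [Set.mem_iUnion]
  constructor
  · rintro ⟨j, h1, h2, h3, -⟩
    exact ⟨fun i => (h3 i).trans h2, j, h1⟩
  · rintro ⟨h1, j, hj⟩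
    obtain ⟨k, -, hk⟩ := Finset.exists_max_image Finset.univ
      (fun i => inner ℝ x (u i) - β i) ⟨j, Finset.mem_univ j⟩
    -- Ties are broken by taking the least label among the maximisers.
    obtain ⟨l, hl, hl'⟩ := Finset.exists_min_image (Finset.univ.filter fun i =>
      inner ℝ x (u k) - β k ≤ inner ℝ x (u i) - β i) f ⟨k, by simp⟩
    rw [Finset.mem_filter] at hl
    refine ⟨l, hj.trans_le ((hk j (Finset.mem_univ j)).trans hl.2), h1 l,
      fun i => (hk i (Finset.mem_univ i)).trans hl.2, fun i hi => ?_⟩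
    by_contra hcon
    exact absurd (hl' i (Finset.mem_filter.2 ⟨Finset.mem_univ i, hl.2.trans (not_lt.1 hcon)⟩))
      (not_le.2 hi)

lemma pairwise_disjoint_maxSlabAt {ι : Type*} {f : ι → ℕ} (hf : Function.Injective f) (u : ι → RVec p)
    (β : ι → ℝ) (lo hi : ℝ) : Pairwise (Function.onFun Disjoint (maxSlabAt f u β lo hi)) := by
  intro i j hij
  refine Set.disjoint_left.2 fun x hi hj => ?_
  rcases lt_or_gt_of_ne (hf.ne hij) with h | h
  · exact absurd (hj.2.2.2 i h) (not_lt.2 (hi.2.2.1 j))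
  · exact absurd (hi.2.2.2 j h) (not_lt.2 (hj.2.2.1 i))

/-- On the piece where j is the first maximiser, shift by h S uⱼ. The j-th variable gains exactly h
and the others gain at most h, since correlations are at most 1. So j remains the first maximiser
and the piece lands in the corresponding piece at height h. There ⟨x, uⱼ⟩ ≤ M + ε bounds the density
ratio, and the disjoint pieces add up. -/
lemma maxSlab_le_shift (hS : S.PosSemidef) {u : ι → RVec p} {β : ι → ℝ}
    (hu : ∀ j, (u j).ofLp ⬝ᵥ (S *ᵥ (u j).ofLp) = 1) {M ε h : ℝ} (hβ : ∀ j, β j ≤ M)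
    (hh : 0 ≤ h) :
    multivariateGaussian 0 S (maxSlab u β 0 ε) ≤
      ENNReal.ofReal (Real.exp (h * (M + ε) + h ^ 2 / 2)) *
        multivariateGaussian 0 S (maxSlab u β h (h + ε)) := by
  set f : ι → ℕ := fun i => (Fintype.equivFin ι i : ℕ) with hf
  have hinj : Function.Injective f := Fin.val_injective.comp (Fintype.equivFin ι).injective
  rw [← iUnion_maxSlabAt f u β 0 ε, ← iUnion_maxSlabAt f u β h (h + ε),
    measure_iUnion (pairwise_disjoint_maxSlabAt hinj u β _ _)
      (measurableSet_maxSlabAt f u β _ _),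
    measure_iUnion (pairwise_disjoint_maxSlabAt hinj u β _ _)
      (measurableSet_maxSlabAt f u β _ _), ← ENNReal.tsum_mul_left]
  refine ENNReal.tsum_le_tsum fun j => ?_
  refine multivariateGaussian_le_shift hS (hu j) (measurableSet_maxSlabAt f u β _ _ j)
    (measurableSet_maxSlabAt f u β _ _ j) hh (fun x hx => ?_) fun x hx => ?_
  · linarith [hx.2.1, hβ j]
  · have hin : ∀ i, inner ℝ (x + h • WithLp.toLp 2 (S *ᵥ (u j).ofLp) : RVec p) (u i) =
        inner ℝ x (u i) + h * ((S *ᵥ (u j).ofLp) ⬝ᵥ (u i).ofLp) := fun i => by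
      rw [inner_add_left, real_inner_smul_left,
        inner_eq_dotProduct (WithLp.toLp 2 (S *ᵥ (u j).ofLp))]
    have hj : (S *ᵥ (u j).ofLp) ⬝ᵥ (u j).ofLp = 1 := by rw [dotProduct_comm]; exact hu j
    have hle : ∀ i, h * ((S *ᵥ (u j).ofLp) ⬝ᵥ (u i).ofLp) ≤ h := fun i =>
      mul_le_of_le_one_right hh (abs_dotProduct_mulVec_le_one hS (hu j) (hu i))
    obtain ⟨h1, h2, h3, h4⟩ := hx
    refine ⟨?_, ?_, fun i => ?_, fun i hi => ?_⟩
    · rw [hin, hj]; linarith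
    · rw [hin, hj]; linarith
    · rw [hin, hin, hj]; linarith [h3 i, hle i]
    · rw [hin, hin, hj]; linarith [h4 i hi, hle i]

lemma exp_two_le_eight : Real.exp 2 ≤ 8 := by
  have h := Real.exp_one_lt_d9
  have e : Real.exp 2 = Real.exp 1 * Real.exp 1 := by rw [← Real.exp_add]; norm_num
  rw [e]
  nlinarith [Real.exp_pos 1]

/-- Anti-concentration of the maximum of Gaussian variables with unit variances. -/
lemma measureReal_maxSlab_le (hS : S.PosSemidef) {u : ι → RVec p} {β : ι → ℝ}
    (hu : ∀ j, (u j).ofLp ⬝ᵥ (S *ᵥ (u j).ofLp) = 1) {M ε : ℝ} (hM : 0 ≤ M)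
    (hβ : ∀ j, β j ≤ M) (hε : 0 < ε) :
    (multivariateGaussian 0 S).real (maxSlab u β 0 ε) ≤ 8 * ε * (M + 1) := by
  set μ : Measure (RVec p) := multivariateGaussian 0 S with hμ
  rcases le_or_gt ε 1 with hε1 | hε1
  swap
  · exact measureReal_le_one.trans (by nlinarith)
  -- The m disjoint slabs (kε, kε + ε] have total mass at most 1. Each carries at least an eighth of
  -- the mass of the lowest one: k < m and ε ≤ 1 keep the shift exponent below 1 + 1/2, and exp 2 ≤
  -- 8.
  set m : ℕ := ⌈1 / (ε * (M + 1))⌉₊ with hm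
  have hpos : 0 < ε * (M + 1) := by positivity
  have hm1 : 1 / (ε * (M + 1)) ≤ m := Nat.le_ceil _
  have hm0 : (0 : ℝ) < m := lt_of_lt_of_le (by positivity) hm1
  have step : ∀ k ∈ Finset.range m, μ.real (maxSlab u β 0 ε) ≤
      8 * μ.real (maxSlab u β (k * ε) (k * ε + ε)) := by
    intro k hk
    have hk : (k : ℝ) < 1 / (ε * (M + 1)) := Nat.lt_ceil.1 (Finset.mem_range.1 hk)
    have hkM : k * ε * (M + 1) ≤ 1 := by
      rw [lt_div_iff₀ hpos] at hk
      linarith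
    have hk0 : 0 ≤ k * ε := by positivity
    have hk1 : k * ε ≤ 1 := le_trans (le_mul_of_one_le_right hk0 (by linarith)) hkM
    have h := maxSlab_le_shift hS hu (ε := ε) hβ hk0
    have hexp : Real.exp (k * ε * (M + ε) + (k * ε) ^ 2 / 2) ≤ 8 := by
      refine le_trans (Real.exp_le_exp.2 ?_) exp_two_le_eight
      nlinarith
    have h' := ENNReal.toReal_mono (by finiteness) h
    rw [ENNReal.toReal_mul, ENNReal.toReal_ofReal (Real.exp_pos _).le] at h'
    exact h'.trans (mul_le_mul_of_nonneg_right hexp measureReal_nonneg)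
  have hsum := Finset.sum_le_sum step
  rw [Finset.sum_const, Finset.card_range, nsmul_eq_mul, ← Finset.mul_sum,
    ← measureReal_biUnion_finset] at hsum
  · have h1 : μ.real (⋃ k ∈ Finset.range m, maxSlab u β (k * ε) (k * ε + ε)) ≤ 1 :=
      measureReal_le_one
    have h2 : m * μ.real (maxSlab u β 0 ε) ≤ 8 := by linarith
    rw [div_le_iff₀ hpos] at hm1
    have h3 := mul_le_mul_of_nonneg_left h2 hpos.le
    have h4 : 0 ≤ μ.real (maxSlab u β 0 ε) := measureReal_nonneg
    nlinarith
  · intro k _ l _ hkl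
    refine Set.disjoint_left.2 fun x hxk hxl => ?_
    have key : ∀ {k l : ℕ}, k < l → x ∈ maxSlab u β (k * ε) (k * ε + ε) →
        x ∈ maxSlab u β (l * ε) (l * ε + ε) → False := by
      rintro k l hkl ⟨hk, -⟩ ⟨-, j, hj⟩
      have hkl' : (k : ℝ) + 1 ≤ l := by exact_mod_cast hkl
      nlinarith [hk j]
    rcases lt_or_gt_of_ne hkl with h | h
    · exact key h hxk hxl
    · exact key h hxl hxk
  · exact fun k _ => measurableSet_maxSlab u β _ _

/-- The polyhedron `⋂ᵢ {x : ⟨x, vᵢ⟩ ≤ bᵢ}`. -/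
def polyhedron (v : ι → RVec p) (b : ι → ℝ) : Set (RVec p) := {x | ∀ i, inner ℝ x (v i) ≤ b i}

lemma measurableSet_polyhedron (v : ι → RVec p) (b : ι → ℝ) :
    MeasurableSet (polyhedron v b) := by
  unfold polyhedron
  rw [Set.ofPred_forall]
  exact MeasurableSet.iInter fun j => measurableSet_le (by fun_prop) measurable_const

lemma gaussianReal_Ioc_le {β ε M : ℝ} (hM : 0 ≤ M) (hβ : M ≤ β) (hε : 0 ≤ ε) :
    (gaussianReal 0 1).real (Set.Ioc β (β + ε)) ≤ ε * Real.exp (-M ^ 2 / 2) := by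
  rw [measureReal_def, gaussianReal_apply_eq_integral _ one_ne_zero,
    ENNReal.toReal_ofReal (integral_nonneg fun x => gaussianPDFReal_nonneg _ _ _)]
  have h := norm_setIntegral_le_of_norm_le_const (μ := volume) (s := Set.Ioc β (β + ε))
    (f := gaussianPDFReal 0 1) (C := Real.exp (-M ^ 2 / 2)) (by simp) fun x hx => by
      rw [Real.norm_eq_abs, abs_of_nonneg (gaussianPDFReal_nonneg _ _ _), gaussianPDFReal_def]
      have h1 : (Real.sqrt (2 * Real.pi * ((1 : NNReal) : ℝ)))⁻¹ ≤ 1 := by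
        refine inv_le_one_of_one_le₀ (Real.one_le_sqrt.2 ?_)
        have := Real.pi_gt_three
        simp only [NNReal.coe_one]
        linarith
      calc _ ≤ 1 * Real.exp (-(x - 0) ^ 2 / (2 * ((1 : NNReal) : ℝ))) :=
            mul_le_mul_of_nonneg_right h1 (Real.exp_pos _).le
        _ ≤ _ := by
            rw [one_mul]
            refine Real.exp_le_exp.2 ?_
            have : M ^ 2 ≤ x ^ 2 := pow_le_pow_left₀ hM (hβ.trans hx.1.le) 2
            simp only [NNReal.coe_one, sub_zero]
            linarith
  rw [Real.norm_eq_abs, measureReal_def, Real.volume_Ioc, ENNReal.toReal_ofReal (by linarith)] at h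
  refine (le_abs_self _).trans (h.trans (le_of_eq ?_))
  ring

/-- **Nazarov's inequality**. -/
theorem measureReal_polyhedron_add_le (hS : S.PosSemidef) {v : ι → RVec p} (b : ι → ℝ)
    {K L ε : ℝ} (hK : 0 < K) (hv : ∀ j, K ≤ (v j).ofLp ⬝ᵥ (S *ᵥ (v j).ofLp))
    (hL : 1 / 2 ≤ L) (hcard : (Fintype.card ι : ℝ) ≤ Real.exp L) (hε : 0 < ε) :
    (multivariateGaussian 0 S).real (polyhedron v fun i => b i + ε) ≤
      (multivariateGaussian 0 S).real (polyhedron v b) +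
        25 * (ε / Real.sqrt K) * Real.sqrt L := by
  classical
  set μ : Measure (RVec p) := multivariateGaussian 0 S with hμ
  set s : ι → ℝ := fun j => Real.sqrt ((v j).ofLp ⬝ᵥ (S *ᵥ (v j).ofLp)) with hs
  have hK' : 0 < Real.sqrt K := Real.sqrt_pos.2 hK
  have hsK : ∀ j, Real.sqrt K ≤ s j := fun j => Real.sqrt_le_sqrt (hv j)
  have hs0 : ∀ j, 0 < s j := fun j => hK'.trans_le (hsK j)
  have hs2 : ∀ j, (v j).ofLp ⬝ᵥ (S *ᵥ (v j).ofLp) = s j ^ 2 := fun j =>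
    (Real.sq_sqrt (hK.le.trans (hv j))).symm
  set u : ι → RVec p := fun j => (s j)⁻¹ • v j with hu
  set β : ι → ℝ := fun j => b j / s j with hβ
  set δ : ℝ := ε / Real.sqrt K with hδ
  have hδ0 : 0 < δ := by positivity
  have hu1 : ∀ j, (u j).ofLp ⬝ᵥ (S *ᵥ (u j).ofLp) = 1 := fun j => by
    simp only [hu, WithLp.ofLp_smul, mulVec_smul, dotProduct_smul, smul_dotProduct, hs2,
      smul_eq_mul]
    have := (hs0 j).ne'
    field_simp
  have hin : ∀ x j, inner ℝ x (u j) = inner ℝ x (v j) / s j := fun x j => by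
    rw [hu, real_inner_smul_right, inv_mul_eq_div]
  -- Threshold for the normalised levels βⱼ. Levels up to M are handled together by the slab bound.
  -- Above M a single strip has mass at most δ exp(−M²/2) = δ exp(−L), so a union bound over at most
  -- exp L strips costs only δ.
  set M : ℝ := Real.sqrt (2 * L) with hMdef
  have hM1 : 1 ≤ M := Real.one_le_sqrt.2 (by linarith)
  have hM2 : M ^ 2 = 2 * L := Real.sq_sqrt (by linarith)
  have hcover : polyhedron v (fun i => b i + ε) ⊆ polyhedron v b ∪
      (maxSlab (fun j : {j // β j ≤ M} => u j) (fun j => β j) 0 δ ∪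
        ⋃ j ∈ Finset.univ.filter (fun j => M < β j),
          (fun x => inner ℝ x (u j)) ⁻¹' Set.Ioc (β j) (β j + δ)) := by
    intro x hx
    by_cases hb : x ∈ polyhedron v b
    · exact Or.inl hb
    have hle : ∀ j, inner ℝ x (u j) ≤ β j + δ := fun j => by
      rw [hin]
      calc inner ℝ x (v j) / s j ≤ (b j + ε) / s j :=
            div_le_div_of_nonneg_right (hx j) (hs0 j).le
        _ = β j + ε / s j := add_div _ _ _
        _ ≤ β j + δ := by
            have := div_le_div_of_nonneg_left hε.le hK' (hsK j)
            linarith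
    right
    obtain ⟨j, hj⟩ := not_forall.1 hb
    have hj' : β j < inner ℝ x (u j) := by
      rw [hin]
      exact div_lt_div_of_pos_right (not_le.1 hj) (hs0 j)
    rcases le_or_gt (β j) M with hbM | hbM
    · left
      exact ⟨fun i => by linarith [hle i], ⟨j, hbM⟩, sub_pos.2 hj'⟩
    · right
      simp only [Finset.mem_filter, Finset.mem_univ, true_and, Set.mem_iUnion]
      exact ⟨j, hbM, hj', hle j⟩
  have hbig : μ.real (⋃ j ∈ Finset.univ.filter (fun j => M < β j),
      (fun x => inner ℝ x (u j)) ⁻¹' Set.Ioc (β j) (β j + δ)) ≤ δ := by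
    refine (measureReal_biUnion_finset_le _ _).trans ?_
    have hterm : ∀ j ∈ Finset.univ.filter (fun j => M < β j),
        μ.real ((fun x => inner ℝ x (u j)) ⁻¹' Set.Ioc (β j) (β j + δ)) ≤
          δ * Real.exp (-L) := fun j hj => by
      have hmap := map_inner_multivariateGaussian hS (u j)
      rw [hu1, Real.toNNReal_one] at hmap
      have h := gaussianReal_Ioc_le (M := M) (by linarith)
        (Finset.mem_filter.1 hj).2.le hδ0.le
      rw [← hmap, map_measureReal_apply (by fun_prop) measurableSet_Ioc] at h
      refine h.trans (le_of_eq ?_)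
      rw [hM2]
      ring_nf
    refine (Finset.sum_le_sum hterm).trans ?_
    rw [Finset.sum_const, nsmul_eq_mul]
    have hc : ((Finset.univ.filter (fun j => M < β j)).card : ℝ) ≤ Real.exp L :=
      le_trans (by exact_mod_cast Finset.card_le_univ _) hcard
    calc _ ≤ Real.exp L * (δ * Real.exp (-L)) :=
          mul_le_mul_of_nonneg_right hc (by positivity)
      _ = δ := by rw [mul_left_comm, ← Real.exp_add, add_neg_cancel, Real.exp_zero, mul_one]
  have hslab := measureReal_maxSlab_le hS (u := fun j : {j // β j ≤ M} => u j)
    (β := fun j => β j) (fun j => hu1 j) (by linarith) (fun j => j.2) hδ0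
  have h1 := (measureReal_mono hcover (measure_ne_top μ _)).trans
    ((measureReal_union_le _ _).trans (add_le_add le_rfl (measureReal_union_le _ _)))
  have hML : M ≤ 1.42 * Real.sqrt L := by
    rw [hMdef, Real.sqrt_mul (by norm_num)]
    refine mul_le_mul_of_nonneg_right ?_ (Real.sqrt_nonneg _)
    rw [Real.sqrt_le_left (by norm_num)]
    norm_num
  -- As 1 ≤ M ≤ 1.42 √L, one has 8(M + 1) + 1 ≤ 17 M ≤ 25 √L.
  have : 8 * δ * (M + 1) + δ ≤ 25 * δ * Real.sqrt L := by nlinarith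
  linarith

end AntiConcentration

/-! ### Gaussian comparison over polyhedra -/

section Polyhedra

variable {p : ℕ}

/-- All exponents are nonpositive on the polyhedron, so the log-sum-exp is at most the logarithm of
the number of constraints. -/
lemma smoothInd_eq_one {ι : Type*} [Fintype ι] [Nonempty ι] {t : ℝ → ℝ} {β L : ℝ}
    {v : ι → RVec p} {b : ι → ℝ} (ht : ∀ l ≤ L, t l = 1) (hβ : 0 ≤ β)
    (hcard : (Fintype.card ι : ℝ) ≤ Real.exp L) {x : RVec p} (hx : x ∈ polyhedron v b) :
    smoothInd t β v b x = 1 := by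
  refine ht _ ?_
  rw [Real.log_le_iff_le_exp (sum_exp_pos _)]
  refine le_trans ?_ hcard
  calc ∑ i, Real.exp (β * (inner ℝ x (v i) - b i)) ≤ ∑ _i : ι, (1 : ℝ) :=
        Finset.sum_le_sum fun i _ => Real.exp_le_one_iff.2
          (mul_nonpos_of_nonneg_of_nonpos hβ (sub_nonpos.2 (hx i)))
    _ = _ := by simp

/-- A single constraint violated by more than δ already pushes the log-sum-exp up to βδ. -/
lemma smoothInd_eq_zero {ι : Type*} [Fintype ι] [Nonempty ι] {t : ℝ → ℝ} {β L δ : ℝ}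
    {v : ι → RVec p} {b : ι → ℝ} (ht : ∀ l, L ≤ l → t l = 0) (hβ : 0 ≤ β) (hδ : L ≤ β * δ)
    {x : RVec p} (hx : x ∉ polyhedron v fun i => b i + δ) : smoothInd t β v b x = 0 := by
  obtain ⟨i, hi⟩ := not_forall.1 hx
  rw [not_le] at hi
  refine ht _ ?_
  rw [Real.le_log_iff_exp_le (sum_exp_pos _)]
  calc Real.exp L ≤ Real.exp (β * (inner ℝ x (v i) - b i)) :=
        Real.exp_le_exp.2 (hδ.trans (mul_le_mul_of_nonneg_left (by linarith) hβ))
    _ ≤ _ := Finset.single_le_sum (f := fun i => Real.exp (β * (inner ℝ x (v i) - b i)))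
        (fun _ _ => (Real.exp_pos _).le) (Finset.mem_univ i)

lemma measureReal_le_integral_of_eq_one {Ω : Type*} [MeasurableSpace Ω] {μ : Measure Ω}
    [IsProbabilityMeasure μ] {f : Ω → ℝ} {A : Set Ω} (hA : MeasurableSet A) (hf : Integrable f μ)
    (hf0 : ∀ x, 0 ≤ f x) (hf1 : ∀ x ∈ A, f x = 1) : μ.real A ≤ ∫ x, f x ∂μ := by
  rw [← integral_indicator_one hA]
  refine integral_mono ((integrable_const (1 : ℝ)).indicator hA) hf fun x => ?_
  by_cases hx : x ∈ A
  · simp [hx, hf1 x hx]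
  · simp [hx, hf0 x]

lemma integral_le_measureReal_of_eq_zero {Ω : Type*} [MeasurableSpace Ω] {μ : Measure Ω}
    [IsProbabilityMeasure μ] {f : Ω → ℝ} {A : Set Ω} (hA : MeasurableSet A) (hf : Integrable f μ)
    (hf1 : ∀ x, f x ≤ 1) (hf0 : ∀ x, x ∉ A → f x = 0) : ∫ x, f x ∂μ ≤ μ.real A := by
  rw [← integral_indicator_one hA]
  refine integral_mono hf ((integrable_const (1 : ℝ)).indicator hA) fun x => ?_
  by_cases hx : x ∈ A
  · simp [hx, hf1 x]
  · simp [hx, hf0 x hx]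

/-- The smoothed indicator lies between the indicators of the polyhedron and of its δ-enlargement.
Stretching the cut-off over [L, 2L] makes its derivatives of order 1/L. With β = 2L/δ this improves
the error from ΔL²/δ² to ΔL/δ². No nondegeneracy is needed at this stage. -/
lemma measureReal_polyhedron_le_smooth : ∃ D : ℝ, 0 < D ∧
    ∀ {p : ℕ} {ι : Type} [Fintype ι] [Nonempty ι] {S T : Matrix (Fin p) (Fin p) ℝ}
      (v : ι → RVec p) (b : ι → ℝ) {L Δ δ : ℝ}, S.PosSemidef → T.PosSemidef → 1 / 2 ≤ L →
      (Fintype.card ι : ℝ) ≤ Real.exp L → 0 < δ →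
      (∀ i j, |(v i).ofLp ⬝ᵥ ((T - S) *ᵥ (v j).ofLp)| ≤ Δ) →
      (multivariateGaussian 0 T).real (polyhedron v b) ≤
        (multivariateGaussian 0 S).real (polyhedron v fun i => b i + δ) +
          D * (Δ * L / δ ^ 2) := by
  obtain ⟨D, g, g1, g2, g3, hD, d0, d1, d2, b1, b2, b3, g0, gle, gone, gzero⟩ :=
    exists_smooth_step
  refine ⟨12 * D, by positivity, ?_⟩
  intro p ι _ _ S T v b L Δ δ hS hT hL hcard hδ hΔ
  have hL0 : 0 < L := by linarith
  have hΔ0 : 0 ≤ Δ := (abs_nonneg _).trans (hΔ (Classical.arbitrary ι) (Classical.arbitrary ι))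
  have hLi : L⁻¹ ≤ 2 := inv_le_of_inv_le₀ (by norm_num) (by linarith)
  have hLi0 : 0 < L⁻¹ := by positivity
  have aff : ∀ l : ℝ, HasDerivAt (fun l => l * L⁻¹ - 1) L⁻¹ l := fun l => by
    simpa using ((hasDerivAt_id l).mul_const L⁻¹).sub_const 1
  set t : ℝ → ℝ := fun l => g (l * L⁻¹ - 1) with ht
  set t1 : ℝ → ℝ := fun l => g1 (l * L⁻¹ - 1) * L⁻¹ with ht1
  set t2 : ℝ → ℝ := fun l => g2 (l * L⁻¹ - 1) * L⁻¹ * L⁻¹ with ht2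
  set t3 : ℝ → ℝ := fun l => g3 (l * L⁻¹ - 1) * L⁻¹ * L⁻¹ * L⁻¹ with ht3
  have D0 : ∀ l, HasDerivAt t (t1 l) l := fun l => (d0 _).comp l (aff l)
  have D1 : ∀ l, HasDerivAt t1 (t2 l) l := fun l => ((d1 _).comp l (aff l)).mul_const _
  have D2 : ∀ l, HasDerivAt t2 (t3 l) l := fun l =>
    (((d2 _).comp l (aff l)).mul_const _).mul_const _
  have A1 : ∀ l, |t1 l| ≤ 2 * D * L⁻¹ := fun l => by
    rw [ht1, abs_mul, abs_of_pos hLi0]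
    exact mul_le_mul_of_nonneg_right ((b1 _).trans (by linarith)) hLi0.le
  -- The second derivative is of order L⁻², which L ≥ 1/2 relaxes to 2 L⁻¹ so that one constant
  -- serves both derivatives.
  have A2 : ∀ l, |t2 l| ≤ 2 * D * L⁻¹ := fun l => by
    rw [ht2, abs_mul, abs_mul, abs_of_pos hLi0]
    refine mul_le_mul_of_nonneg_right ?_ hLi0.le
    have := mul_le_mul (b2 (l * L⁻¹ - 1)) hLi hLi0.le hD.le
    linarith
  have A3 : ∀ l, |t3 l| ≤ D * L⁻¹ * L⁻¹ * L⁻¹ := fun l => by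
    rw [ht3, abs_mul, abs_mul, abs_mul, abs_of_pos hLi0]
    have := b3 (l * L⁻¹ - 1)
    gcongr
  set B : ℝ := 2 * D * L⁻¹ + D * L⁻¹ * L⁻¹ * L⁻¹ with hB
  have hp1 : 0 ≤ 2 * D * L⁻¹ := by positivity
  have hp2 : 0 ≤ D * L⁻¹ * L⁻¹ * L⁻¹ := by positivity
  have hcmp := abs_integral_smoothInd_multivariateGaussian_sub_le (β := 2 * L / δ) (v := v) (b := b)
    D0 D1 D2 (fun l => (A1 l).trans (by linarith)) (fun l => (A2 l).trans (by linarith))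
    (fun l => (A3 l).trans (by linarith) : ∀ l, |t3 l| ≤ B)
    (fun l => abs_le.2 ⟨by linarith [g0 (l * L⁻¹ - 1)], gle _⟩) A1 A2 hT hS hΔ
  have hcont : Continuous (smoothInd t (2 * L / δ) v b) :=
    continuous_smoothInd (continuous_iff_continuousAt.2 fun l => (D0 l).continuousAt)
  have hint : ∀ U : Matrix (Fin p) (Fin p) ℝ,
      Integrable (smoothInd t (2 * L / δ) v b) (multivariateGaussian 0 U) := fun U =>
    (integrable_const (1 : ℝ)).mono' hcont.aestronglyMeasurable
      (Filter.Eventually.of_forall fun y => abs_le.2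
        ⟨by linarith [g0 (Real.log (∑ i, Real.exp (2 * L / δ * (inner ℝ y (v i) - b i))) * L⁻¹ - 1),
          show smoothInd t (2 * L / δ) v b y = g (Real.log (∑ i, Real.exp (2 * L / δ *
            (inner ℝ y (v i) - b i))) * L⁻¹ - 1) from rfl], gle _⟩)
  have hone : ∀ l ≤ L, t l = 1 := fun l hl => gone _ (by
    rw [sub_nonpos, ← div_eq_mul_inv, div_le_one hL0]
    exact hl)
  have hzero : ∀ l, 2 * L ≤ l → t l = 0 := fun l hl => gzero _ (by
    rw [le_sub_iff_add_le, ← div_eq_mul_inv, le_div_iff₀ hL0]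
    linarith)
  have hβ : 0 ≤ 2 * L / δ := by positivity
  have up := measureReal_le_integral_of_eq_one (measurableSet_polyhedron v b) (hint T)
    (fun x => g0 _) fun x hx => smoothInd_eq_one hone hβ hcard hx
  have down := integral_le_measureReal_of_eq_zero
    (measurableSet_polyhedron v fun i => b i + δ) (hint S)
    (fun x => gle _) fun x hx => smoothInd_eq_zero hzero hβ
      (by rw [div_mul_cancel₀ _ hδ.ne']) hx
  have he : 3 / 2 * (2 * D * L⁻¹) * Δ * (2 * L / δ) ^ 2 = 12 * D * (Δ * L / δ ^ 2) := by
    field_simp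
    ring
  rw [he] at hcmp
  linarith [(abs_le.1 hcmp).2]

lemma rpow_third_mul_sqrt {Δ L : ℝ} (hΔ : 0 < Δ) (hL : 0 < L) :
    (Δ * Real.sqrt L) ^ (1 / 3 : ℝ) * Real.sqrt L = Δ ^ (1 / 3 : ℝ) * L ^ (2 / 3 : ℝ) := by
  rw [Real.mul_rpow hΔ.le (Real.sqrt_nonneg _), Real.sqrt_eq_rpow, ← Real.rpow_mul hL.le,
    mul_assoc, ← Real.rpow_add hL]
  norm_num

/-- Comparison of two centred Gaussian measures over polyhedra, when the first of them is
nondegenerate in the directions of the normals. -/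
theorem exists_abs_measureReal_polyhedron_sub_le : ∃ C : ℝ, 0 < C ∧
    ∀ {p : ℕ} {ι : Type} [Fintype ι] {S T : Matrix (Fin p) (Fin p) ℝ}
      (v : ι → RVec p) (b : ι → ℝ) {K L Δ : ℝ}, S.PosSemidef → T.PosSemidef → 0 < K →
      (∀ j, K ≤ (v j).ofLp ⬝ᵥ (S *ᵥ (v j).ofLp)) → 1 / 2 ≤ L →
      (Fintype.card ι : ℝ) ≤ Real.exp L → 0 ≤ Δ →
      (∀ i j, |(v i).ofLp ⬝ᵥ ((T - S) *ᵥ (v j).ofLp)| ≤ Δ) →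
      |(multivariateGaussian 0 T).real (polyhedron v b) -
        (multivariateGaussian 0 S).real (polyhedron v b)| ≤
        C * (1 + (Real.sqrt K)⁻¹) * (Δ ^ (1 / 3 : ℝ) * L ^ (2 / 3 : ℝ)) := by
  obtain ⟨D, hD, hmain⟩ := measureReal_polyhedron_le_smooth
  refine ⟨D + 25, by positivity, ?_⟩
  intro p ι _ S T v b K L Δ hS hT hK hv hL hcard hΔ0 hΔ
  have hL0 : 0 < L := by linarith
  have hKi : 0 < (Real.sqrt K)⁻¹ := inv_pos.2 (Real.sqrt_pos.2 hK)
  rcases isEmpty_or_nonempty ι with hι | hι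
  · have huniv : polyhedron v b = Set.univ := Set.eq_univ_of_forall fun x i => hι.elim i
    rw [huniv]
    simp only [probReal_univ, sub_self, abs_zero]
    positivity
  -- The smoothing width must be positive, so Δ is enlarged slightly; letting Δ' decrease to Δ also
  -- covers Δ = 0.
  have key : ∀ Δ' : ℝ, 0 < Δ' → Δ ≤ Δ' → |(multivariateGaussian 0 T).real (polyhedron v b) -
        (multivariateGaussian 0 S).real (polyhedron v b)| ≤
        (D + 25) * (1 + (Real.sqrt K)⁻¹) * (Δ' ^ (1 / 3 : ℝ) * L ^ (2 / 3 : ℝ)) := by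
    intro Δ' hΔ'0 hΔΔ'
    have hΔ' : ∀ i j, |(v i).ofLp ⬝ᵥ ((T - S) *ᵥ (v j).ofLp)| ≤ Δ' := fun i j =>
      (hΔ i j).trans hΔΔ'
    have hΔ'' : ∀ i j, |(v i).ofLp ⬝ᵥ ((S - T) *ᵥ (v j).ofLp)| ≤ Δ' := fun i j => by
      have := hΔ' i j
      rwa [← neg_sub, neg_mulVec, dotProduct_neg, abs_neg] at this
    have hsL : 0 < Real.sqrt L := Real.sqrt_pos.2 hL0
    rw [← rpow_third_mul_sqrt hΔ'0 hL0]
    -- This width equates the smoothing error Δ'L/δ² with the anti-concentration error δ√L.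
    set δ : ℝ := (Δ' * Real.sqrt L) ^ (1 / 3 : ℝ) with hδ
    have hδ0 : 0 < δ := by positivity
    have hδ3 : δ ^ 3 = Δ' * Real.sqrt L := by
      rw [hδ, ← Real.rpow_natCast, ← Real.rpow_mul (by positivity)]
      norm_num
    have hE : Δ' * L / δ ^ 2 = δ * Real.sqrt L := by
      rw [div_eq_iff (by positivity)]
      have : L = Real.sqrt L * Real.sqrt L := (Real.mul_self_sqrt hL0.le).symm
      calc Δ' * L = Δ' * Real.sqrt L * Real.sqrt L := by rw [mul_assoc, ← this]
        _ = δ * Real.sqrt L * δ ^ 2 := by rw [← hδ3]; ring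
    have up := hmain v b hS hT hL hcard hδ0 hΔ'
    -- The reverse inequality shrinks the polyhedron by δ and exchanges the two measures, so that
    -- both uses of Nazarov's inequality are under S.
    have down := hmain v (fun i => b i - δ) hT hS hL hcard hδ0 hΔ''
    have nz1 := measureReal_polyhedron_add_le hS b hK hv hL hcard hδ0
    have nz2 := measureReal_polyhedron_add_le hS (fun i => b i - δ) hK hv hL hcard hδ0
    simp only [sub_add_cancel] at down nz2
    rw [hE] at up down
    have hp : 0 < δ * Real.sqrt L := by positivity
    have hq : 0 < δ * Real.sqrt L * (Real.sqrt K)⁻¹ := by positivity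
    have hr : 0 < D * (δ * Real.sqrt L * (Real.sqrt K)⁻¹) := by positivity
    have hexp : (D + 25) * (1 + (Real.sqrt K)⁻¹) * (δ * Real.sqrt L) =
        D * (δ * Real.sqrt L) + 25 * (δ / Real.sqrt K) * Real.sqrt L +
          25 * (δ * Real.sqrt L) + D * (δ * Real.sqrt L * (Real.sqrt K)⁻¹) := by
      rw [div_eq_mul_inv]
      ring
    rw [hexp, abs_le]
    constructor <;> linarith
  have hlim : Filter.Tendsto (fun Δ' : ℝ => (D + 25) * (1 + (Real.sqrt K)⁻¹) *
      (Δ' ^ (1 / 3 : ℝ) * L ^ (2 / 3 : ℝ))) (nhdsWithin Δ (Set.Ioi Δ))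
      (nhds ((D + 25) * (1 + (Real.sqrt K)⁻¹) * (Δ ^ (1 / 3 : ℝ) * L ^ (2 / 3 : ℝ)))) := by
    refine Filter.Tendsto.mono_left ?_ nhdsWithin_le_nhds
    exact (((Real.continuousAt_rpow_const Δ (1 / 3) (Or.inr (by norm_num))).tendsto).mul_const
      _).const_mul _
  refine ge_of_tendsto hlim ?_
  filter_upwards [self_mem_nhdsWithin] with Δ' hΔ'
  exact key Δ' (hΔ0.trans_lt hΔ') (le_of_lt hΔ')

/-- Comparison over sets which are sandwiched between a polyhedron and its `ε`-enlargement, up to an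
exceptional set. -/
theorem exists_abs_measureReal_sub_le_of_sandwich : ∃ C : ℝ, 0 < C ∧
    ∀ {p : ℕ} {ι : Type} [Fintype ι] {S T : Matrix (Fin p) (Fin p) ℝ}
      (v : ι → RVec p) (b : ι → ℝ) {K L Δ ε : ℝ}, S.PosSemidef → T.PosSemidef → 0 < K →
      (∀ j, K ≤ (v j).ofLp ⬝ᵥ (S *ᵥ (v j).ofLp)) → 1 / 2 ≤ L →
      (Fintype.card ι : ℝ) ≤ Real.exp L → 0 ≤ Δ →
      (∀ i j, |(v i).ofLp ⬝ᵥ ((T - S) *ᵥ (v j).ofLp)| ≤ Δ) → 0 ≤ ε →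
      ∀ {A E : Set (RVec p)}, polyhedron v b \ E ⊆ A → A \ E ⊆ polyhedron v (fun i => b i + ε) →
      |(multivariateGaussian 0 T).real A - (multivariateGaussian 0 S).real A| ≤
        C * (1 + (Real.sqrt K)⁻¹) *
          (Δ ^ (1 / 3 : ℝ) * L ^ (2 / 3 : ℝ) + ε * L ^ (1 / 2 : ℝ)) +
        (multivariateGaussian 0 S).real E + (multivariateGaussian 0 T).real E := by
  obtain ⟨C, hC, hmain⟩ := exists_abs_measureReal_polyhedron_sub_le
  refine ⟨C + 25, by positivity, ?_⟩
  intro p ι _ S T v b K L Δ ε hS hT hK hv hL hcard hΔ0 hΔ hε A E h1 h2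
  have c1 := hmain v b hS hT hK hv hL hcard hΔ0 hΔ
  have c2 := hmain v (fun i => b i + ε) hS hT hK hv hL hcard hΔ0 hΔ
  have hL0 : 0 < L := by linarith
  have hKi : 0 < (Real.sqrt K)⁻¹ := inv_pos.2 (Real.sqrt_pos.2 hK)
  have nz : (multivariateGaussian 0 S).real (polyhedron v fun i => b i + ε) ≤
      (multivariateGaussian 0 S).real (polyhedron v b) +
        25 * (ε / Real.sqrt K) * Real.sqrt L := by
    rcases hε.eq_or_lt with h | h
    · simp [← h]
    · exact measureReal_polyhedron_add_le hS b hK hv hL hcard h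
  have lo : ∀ μ : Measure (RVec p), IsProbabilityMeasure μ →
      μ.real (polyhedron v b) ≤ μ.real A + μ.real E := fun μ _ =>
    (measureReal_mono (Set.sdiff_subset_iff.1 (by rwa [Set.sdiff_subset_iff, Set.union_comm,
      ← Set.sdiff_subset_iff] : polyhedron v b \ A ⊆ E))).trans (measureReal_union_le _ _)
  have hi : ∀ μ : Measure (RVec p), IsProbabilityMeasure μ →
      μ.real A ≤ μ.real (polyhedron v fun i => b i + ε) + μ.real E := fun μ _ => by
    rw [add_comm]
    exact (measureReal_mono (Set.sdiff_subset_iff.1 h2)).trans (measureReal_union_le _ _)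
  have loS := lo (multivariateGaussian 0 S) inferInstance
  have loT := lo (multivariateGaussian 0 T) inferInstance
  have hiS := hi (multivariateGaussian 0 S) inferInstance
  have hiT := hi (multivariateGaussian 0 T) inferInstance
  rw [← Real.sqrt_eq_rpow]
  set Q := Δ ^ (1 / 3 : ℝ) * L ^ (2 / 3 : ℝ) with hQ
  have hQ0 : 0 ≤ Q := by positivity
  have hexp : (C + 25) * (1 + (Real.sqrt K)⁻¹) * (Q + ε * Real.sqrt L) =
      C * (1 + (Real.sqrt K)⁻¹) * Q + 25 * (ε / Real.sqrt K) * Real.sqrt L +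
        (25 * (1 + (Real.sqrt K)⁻¹) * Q + 25 * (ε * Real.sqrt L) +
          C * (1 + (Real.sqrt K)⁻¹) * (ε * Real.sqrt L)) := by
    rw [div_eq_mul_inv]
    ring
  have hrest : 0 ≤ 25 * (1 + (Real.sqrt K)⁻¹) * Q + 25 * (ε * Real.sqrt L) +
      C * (1 + (Real.sqrt K)⁻¹) * (ε * Real.sqrt L) := by positivity
  rw [hexp]
  rw [abs_le] at *
  constructor <;> linarith [c1.1, c1.2, c2.1, c2.2]

/-- The version for polyhedra whose right-hand sides may be infinite. -/
theorem exists_abs_measureReal_sub_le_of_sandwich_ereal : ∃ C : ℝ, 0 < C ∧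
    ∀ {p : ℕ} {ι : Type} [Fintype ι] {S T : Matrix (Fin p) (Fin p) ℝ}
      (v : ι → RVec p) (b : ι → EReal) {K L Δ ε : ℝ}, S.PosSemidef → T.PosSemidef → 0 < K →
      (∀ j, K ≤ (v j).ofLp ⬝ᵥ (S *ᵥ (v j).ofLp)) → 1 / 2 ≤ L →
      (Fintype.card ι : ℝ) ≤ Real.exp L → 0 ≤ Δ →
      (∀ i j, |(v i).ofLp ⬝ᵥ ((T - S) *ᵥ (v j).ofLp)| ≤ Δ) → 0 ≤ ε →
      ∀ {A : Set (RVec p)}, (∀ i, b i ≠ ⊥) → {w | ∀ i, ((inner ℝ w (v i) : ℝ) : EReal) ≤ b i} ⊆ A →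
      A ⊆ {w | ∀ i, ((inner ℝ w (v i) : ℝ) : EReal) ≤ b i + (ε : EReal)} →
      |(multivariateGaussian 0 T).real A - (multivariateGaussian 0 S).real A| ≤
        C * (1 + (Real.sqrt K)⁻¹) *
          (Δ ^ (1 / 3 : ℝ) * L ^ (2 / 3 : ℝ) + ε * L ^ (1 / 2 : ℝ)) := by
  classical
  obtain ⟨C, hC, hmain⟩ := exists_abs_measureReal_sub_le_of_sandwich
  refine ⟨C, hC, ?_⟩
  intro p ι _ S T v b K L Δ ε hS hT hK hv hL hcard hΔ0 hΔ hε A hb h1 h2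
  have hcard' : (Fintype.card {i // b i ≠ ⊤} : ℝ) ≤ Real.exp L :=
    le_trans (by exact_mod_cast Fintype.card_subtype_le _) hcard
  -- Constraints with right-hand side ⊤ are void and are dropped, which leaves real bounds.
  have key := hmain (fun i : {i // b i ≠ ⊤} => v i) (fun i => (b i).toReal) (A := A) (E := ∅)
    hS hT hK (fun j => hv j) hL hcard' hΔ0 (fun i j => hΔ i j) hε ?_ ?_
  · simpa using key
  · rw [Set.sdiff_empty]
    refine fun x hx => h1 fun i => ?_
    by_cases hi : b i = ⊤
    · simp [hi]
    · rw [← EReal.coe_toReal hi (hb i), EReal.coe_le_coe_iff]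
      exact hx ⟨i, hi⟩
  · rw [Set.sdiff_empty]
    intro x hx i
    have := h2 hx i
    rwa [← EReal.coe_toReal i.2 (hb i), ← EReal.coe_add, EReal.coe_le_coe_iff] at this

end Polyhedra

/-! ### The long-run covariance matrix -/

section Covariance

variable {n p : ℕ} {Ω : Type*} [MeasurableSpace Ω] {P : Measure Ω}
  {X : Fin n → Ω → RVec p}

lemma scaledSum_apply {n p : ℕ} {Ω : Type*} (X : Fin n → Ω → RVec p) (ω : Ω) (j : Fin p) :
    scaledSum X ω j = (Real.sqrt n)⁻¹ * ∑ t, X t ω j := by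
  simp [scaledSum]

lemma measurable_scaledSum (hX : ∀ t, Measurable (X t)) : Measurable (scaledSum X) := by
  unfold scaledSum
  exact (Finset.measurable_fun_sum _ fun t _ => hX t).const_smul (Real.sqrt n)⁻¹

lemma memLp_scaledSum (hX : ∀ t, MemLp (X t) 2 P) : MemLp (scaledSum X) 2 P := by
  unfold scaledSum
  exact (memLp_finsetSum _ fun t _ => hX t).const_smul (Real.sqrt n)⁻¹

lemma memLp_eval {Y : Ω → RVec p} (hY : MemLp Y 2 P) (j : Fin p) :
    MemLp (fun ω => Y ω j) 2 P :=
  (EuclideanSpace.proj (𝕜 := ℝ) j).comp_memLp' hY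

lemma longRunCov_self (hX : ∀ t, MemLp (X t) 2 P) (j : Fin p) :
    longRunCov P X j j = coordLongRunVar P X j := by
  rw [longRunCov, Matrix.of_apply, covariance_self
    (memLp_eval (memLp_scaledSum hX) j).aestronglyMeasurable.aemeasurable, coordLongRunVar]
  simp_rw [scaledSum_apply]

variable [IsProbabilityMeasure P]

lemma dotProduct_longRunCov (hX : ∀ t, MemLp (X t) 2 P) (v : RVec p) :
    v.ofLp ⬝ᵥ (longRunCov P X *ᵥ v.ofLp) = dirLongRunVar P X v := by
  have hj : ∀ j, MemLp (fun ω => v j * scaledSum X ω j) 2 P := fun j =>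
    (memLp_eval (memLp_scaledSum hX) j).const_mul _
  have e : (fun ω => (Real.sqrt n)⁻¹ * ∑ t, inner ℝ v (X t ω)) =
      fun ω => ∑ j, v j * scaledSum X ω j := by
    ext ω
    simp only [inner_eq_dotProduct, dotProduct, scaledSum_apply, Finset.mul_sum]
    rw [Finset.sum_comm]
    exact Finset.sum_congr rfl fun j _ => Finset.sum_congr rfl fun t _ => by ring
  rw [dirLongRunVar, e, ← covariance_self (by
    exact (Finset.aemeasurable_fun_sum _ fun j _ => (hj j).aestronglyMeasurable.aemeasurable)),
    covariance_fun_sum_fun_sum hj hj]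
  simp only [dotProduct, mulVec, longRunCov, Matrix.of_apply, Finset.mul_sum,
    covariance_const_mul_left, covariance_const_mul_right]
  exact Finset.sum_congr rfl fun i _ => Finset.sum_congr rfl fun j _ => by ring

lemma posSemidef_longRunCov (hX : ∀ t, MemLp (X t) 2 P) : (longRunCov P X).PosSemidef := by
  refine PosSemidef.of_dotProduct_mulVec_nonneg ?_ fun x => ?_
  · ext i j
    simp [longRunCov, covariance_comm]
  · rw [star_trivial]
    have := dotProduct_longRunCov hX (WithLp.toLp 2 x)
    rw [this]
    exact variance_nonneg _ _

lemma sq_le_exp_rpow {γ x : ℝ} (hγ : 1 ≤ γ) (hx : 0 ≤ x) :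
    x ^ 2 ≤ 1 + 2 * (Real.exp (x ^ γ) - 1) := by
  rcases le_or_gt x 1 with h | h
  · have : 1 ≤ Real.exp (x ^ γ) := Real.one_le_exp (by positivity)
    nlinarith
  · have h1 : x ≤ x ^ γ := Real.self_le_rpow_of_one_le h.le hγ
    have h2 := Real.exp_le_exp.2 h1
    have h3 := Real.quadratic_le_exp_of_nonneg hx
    linarith

/-- The second moment is controlled by the Orlicz norm. -/
lemma integral_sq_le_of_psiNorm_le {γ B : ℝ} (hγ : 1 ≤ γ) (hB : 0 < B) {ξ : Ω → ℝ}
    (hm : Measurable ξ) (h : psiNorm P γ ξ ≤ ENNReal.ofReal B) :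
    ∫ ω, ξ ω ^ 2 ∂P ≤ 12 * B ^ 2 := by
  -- Doubling B gives an admissible scale l < 2B without asking whether the infimum is attained;
  -- then 3 l² ≤ 12 B².
  have hlt : psiNorm P γ ξ < ENNReal.ofReal (2 * B) :=
    h.trans_lt ((ENNReal.ofReal_lt_ofReal_iff (by positivity)).2 (by linarith))
  simp only [psiNorm, iInf_lt_iff] at hlt
  obtain ⟨l, hl, hint, hlB⟩ := hlt
  rw [ENNReal.ofReal_lt_ofReal_iff (by positivity)] at hlB
  have hpt : ∀ ω, ENNReal.ofReal (ξ ω ^ 2) ≤ ENNReal.ofReal (l ^ 2) *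
      (1 + 2 * ENNReal.ofReal (Real.exp ((|ξ ω| / l) ^ γ) - 1)) := fun ω => by
    have h0 : 0 ≤ Real.exp ((|ξ ω| / l) ^ γ) - 1 :=
      sub_nonneg.2 (Real.one_le_exp (by positivity))
    rw [← ENNReal.ofReal_one, ← ENNReal.ofReal_ofNat 2, ← ENNReal.ofReal_mul (by norm_num),
      ← ENNReal.ofReal_add zero_le_one (by positivity), ← ENNReal.ofReal_mul (sq_nonneg l)]
    refine ENNReal.ofReal_le_ofReal ?_
    have := sq_le_exp_rpow hγ (div_nonneg (abs_nonneg (ξ ω)) hl.le)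
    rw [div_pow, sq_abs, div_le_iff₀ (by positivity)] at this
    linarith
  have hle : ∫⁻ ω, ENNReal.ofReal (ξ ω ^ 2) ∂P ≤ ENNReal.ofReal (12 * B ^ 2) := by
    refine (lintegral_mono hpt).trans ?_
    rw [lintegral_const_mul' _ _ ENNReal.ofReal_ne_top, lintegral_add_left measurable_const,
      lintegral_const_mul' _ _ (by simp), lintegral_const, measure_univ, mul_one]
    calc _ ≤ ENNReal.ofReal (l ^ 2) * (1 + 2 * 1) := by gcongr
      _ = ENNReal.ofReal (l ^ 2 * 3) := by
          rw [ENNReal.ofReal_mul (sq_nonneg l)]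
          congr 1
          norm_num
      _ ≤ _ := ENNReal.ofReal_le_ofReal (by nlinarith)
  rw [integral_eq_lintegral_of_nonneg_ae (Filter.Eventually.of_forall fun ω => sq_nonneg _)
    (by fun_prop)]
  exact ENNReal.toReal_le_of_le_ofReal (by positivity) hle

/-- Under arbitrary dependence only Cauchy–Schwarz over t is available, hence the factor n. Such
polynomial growth is harmless because the bound serves only to choose a large box. -/
lemma longRunCov_self_le (hX : ∀ t, Measurable (X t)) (hX2 : ∀ t, MemLp (X t) 2 P) {γ B : ℝ}
    (hγ : 1 ≤ γ) (hB : 0 < B)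
    (h : ∀ t j, psiNorm P γ (fun ω => X t ω j) ≤ ENNReal.ofReal B) (j : Fin p) :
    longRunCov P X j j ≤ 12 * n * B ^ 2 := by
  have hXj : ∀ t, MemLp (fun ω => X t ω j) 2 P := fun t => memLp_eval (hX2 t) j
  have hS := memLp_eval (memLp_scaledSum hX2) j
  rw [longRunCov, Matrix.of_apply, covariance_self hS.aestronglyMeasurable.aemeasurable]
  refine (variance_le_expectation_sq hS.aestronglyMeasurable).trans ?_
  calc ∫ ω, ((fun ω => scaledSum X ω j) ^ 2) ω ∂P ≤ ∫ ω, ∑ t, (X t ω j) ^ 2 ∂P := by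
        refine integral_mono hS.integrable_sq
          (integrable_finsetSum _ fun t _ => (hXj t).integrable_sq) fun ω => ?_
        simp only [Pi.pow_apply, scaledSum_apply, mul_pow, inv_pow]
        rw [Real.sq_sqrt (Nat.cast_nonneg n)]
        have hcs := sq_sum_le_card_mul_sum_sq (s := Finset.univ) (f := fun t => X t ω j)
        rw [Finset.card_univ, Fintype.card_fin] at hcs
        rcases Nat.eq_zero_or_pos n with h0 | h0
        · subst h0
          simp
        · rw [inv_mul_le_iff₀ (by exact_mod_cast h0)]
          exact hcs
    _ = ∑ t, ∫ ω, (X t ω j) ^ 2 ∂P := integral_finsetSum _ fun t _ => (hXj t).integrable_sq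
    _ ≤ ∑ _t : Fin n, 12 * B ^ 2 := Finset.sum_le_sum fun t _ =>
        integral_sq_le_of_psiNorm_le hγ hB (by fun_prop) (h t j)
    _ = _ := by
        rw [Finset.sum_const, Finset.card_univ, Fintype.card_fin, nsmul_eq_mul]
        ring

end Covariance

/-! ### Bounds for bilinear forms -/

section Bilinear

variable {p : ℕ}

lemma abs_apply_le_supNorm (M : Matrix (Fin p) (Fin p) ℝ) (i j : Fin p) : |M i j| ≤ supNorm M :=
  (le_ciSup (f := fun j => |M i j|) (Set.finite_range _).bddAbove j).trans
    (le_ciSup (f := fun i => ⨆ j, |M i j|) (Set.finite_range _).bddAbove i)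

lemma supNorm_nonneg (M : Matrix (Fin p) (Fin p) ℝ) : 0 ≤ supNorm M :=
  Real.iSup_nonneg fun _ => Real.iSup_nonneg fun _ => abs_nonneg _

lemma abs_bilin_le_supNorm (M : Matrix (Fin p) (Fin p) ℝ) (v w : Fin p → ℝ) :
    |v ⬝ᵥ (M *ᵥ w)| ≤ (∑ i, |v i|) * (∑ j, |w j|) * supNorm M := by
  simp only [dotProduct, mulVec]
  have hrow : ∀ i, |∑ j, M i j * w j| ≤ (∑ j, |w j|) * supNorm M := fun i => by
    rw [Finset.sum_mul]
    refine (Finset.abs_sum_le_sum_abs _ _).trans (Finset.sum_le_sum fun j _ => ?_)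
    rw [abs_mul, mul_comm]
    exact mul_le_mul_of_nonneg_left (abs_apply_le_supNorm M i j) (abs_nonneg _)
  rw [mul_assoc, Finset.sum_mul]
  refine (Finset.abs_sum_le_sum_abs _ _).trans (Finset.sum_le_sum fun i _ => ?_)
  rw [abs_mul]
  exact mul_le_mul_of_nonneg_left (hrow i) (abs_nonneg _)

lemma abs_apply_le_one {v : RVec p} (hv : ‖v‖ = 1) (j : Fin p) : |v j| ≤ 1 := by
  rw [← hv]
  exact PiLp.norm_apply_le v j

/-- Each coordinate of a unit vector is at most 1 in absolute value. Cauchy–Schwarz would give a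
square root, but the final factor s² leaves room for the cruder bound. -/
lemma sum_abs_le_l0Norm {v : RVec p} (hv : ‖v‖ = 1) : ∑ j, |v j| ≤ l0Norm v := by
  calc ∑ j, |v j| ≤ ∑ j, if v j ≠ 0 then (1 : ℝ) else 0 := by
        refine Finset.sum_le_sum fun j _ => ?_
        split_ifs with h
        · exact abs_apply_le_one hv j
        · simp [not_not.1 h]
    _ = _ := by rw [Finset.sum_boole, l0Norm]

lemma l0Norm_le (v : RVec p) : l0Norm v ≤ p := by
  exact (Finset.card_filter_le (Finset.univ : Finset (Fin p)) fun j => v j ≠ 0).trans (by simp)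

lemma abs_bilin_le_of_l0Norm_le (M : Matrix (Fin p) (Fin p) ℝ) {v w : RVec p} (hv : ‖v‖ = 1)
    (hw : ‖w‖ = 1) {s : ℕ} (hvs : l0Norm v ≤ s) (hws : l0Norm w ≤ s) :
    |v.ofLp ⬝ᵥ (M *ᵥ w.ofLp)| ≤ (s : ℝ) ^ 2 * supNorm M := by
  refine (abs_bilin_le_supNorm M v.ofLp w.ofLp).trans
    (mul_le_mul_of_nonneg_right ?_ (supNorm_nonneg M))
  rw [sq]
  refine mul_le_mul ((sum_abs_le_l0Norm hv).trans (by exact_mod_cast hvs))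
    ((sum_abs_le_l0Norm hw).trans (by exact_mod_cast hws))
    (Finset.sum_nonneg fun _ _ => abs_nonneg _) (Nat.cast_nonneg s)

lemma abs_bilin_le_deltaOver (AK : Set (RVec p) → GeneratedSet p) {𝒜 : Set (Set (RVec p))}
    (M : Matrix (Fin p) (Fin p) ℝ) {A : Set (RVec p)} (hA : A ∈ 𝒜) {v w : RVec p}
    (hv : v ∈ (AK A).normals) (hw : w ∈ (AK A).normals) :
    |v.ofLp ⬝ᵥ (M *ᵥ w.ofLp)| ≤ deltaOver AK 𝒜 M := by
  -- A real `sSup` is 0 on unbounded sets, so an upper bound must be exhibited; unit normals have at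
  -- most p nonzero coordinates.
  refine le_csSup ⟨(p : ℝ) ^ 2 * supNorm M, ?_⟩ ⟨A, hA, v, hv, w, hw, rfl⟩
  rintro r ⟨A, -, v, hv, w, hw, rfl⟩
  exact abs_bilin_le_of_l0Norm_le M ((AK A).norm_eq_one v hv) ((AK A).norm_eq_one w hw)
    (l0Norm_le v) (l0Norm_le w)

lemma deltaOver_nonneg (AK : Set (RVec p) → GeneratedSet p) (𝒜 : Set (Set (RVec p)))
    (M : Matrix (Fin p) (Fin p) ℝ) : 0 ≤ deltaOver AK 𝒜 M :=
  Real.sSup_nonneg (by rintro r ⟨A, -, v, -, w, -, rfl⟩; exact abs_nonneg _)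

end Bilinear

/-! ### Reduction to a comparison of Gaussian measures -/

lemma rho_nonneg {n p : ℕ} {Ω : Type*} [MeasurableSpace Ω] (P : Measure Ω)
    (X : Fin n → Ω → RVec p) (𝒜 : Set (Set (RVec p))) : 0 ≤ rho P X 𝒜 :=
  Real.sSup_nonneg (by rintro r ⟨A, -, rfl⟩; exact abs_nonneg _)

/-- Triangle inequality through N(0, Ξ), at an outcome where the conditional law is Gaussian. This
removes the law of the partial sum from the problem. -/
lemma rhoHat_le_rho_add {n p : ℕ} {Ω : Type*} [MeasurableSpace Ω] {P : Measure Ω}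
    [IsProbabilityMeasure P] {X : Fin n → Ω → RVec p} (hX : ∀ t, Measurable (X t))
    {Ghat : Ω → RVec p} {𝒜 : Set (Set (RVec p))} {ω : Ω} {T : Matrix (Fin p) (Fin p) ℝ}
    (hω : condDistrib Ghat (sample X) P (sample X ω) = multivariateGaussian 0 T) {r : ℝ}
    (hr : 0 ≤ r) (h : ∀ A ∈ 𝒜, |(multivariateGaussian 0 T).real A -
      (multivariateGaussian 0 (longRunCov P X)).real A| ≤ r) :
    rhoHat P X Ghat 𝒜 ω ≤ rho P X 𝒜 + r := by
  have hprob : IsProbabilityMeasure (P.map (scaledSum X)) :=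
    Measure.isProbabilityMeasure_map (measurable_scaledSum hX).aemeasurable
  have hbdd : BddAbove {r | ∃ A ∈ 𝒜, r = |(P.map (scaledSum X)).real A -
      (multivariateGaussian 0 (longRunCov P X)).real A|} := by
    refine ⟨1, ?_⟩
    rintro r ⟨A, -, rfl⟩
    rw [abs_le]
    constructor <;> linarith [measureReal_le_one (μ := P.map (scaledSum X)) (s := A),
      measureReal_nonneg (μ := P.map (scaledSum X)) (s := A),
      measureReal_le_one (μ := (multivariateGaussian 0 (longRunCov P X) : Measure (RVec p)))
        (s := A),
      measureReal_nonneg (μ := (multivariateGaussian 0 (longRunCov P X) : Measure (RVec p)))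
        (s := A)]
  have hrho := rho_nonneg P X 𝒜
  rw [rhoHat, hω, distOver]
  refine Real.sSup_le ?_ (by positivity)
  rintro _ ⟨A, hA, rfl⟩
  have h1 : |(P.map (scaledSum X)).real A -
      (multivariateGaussian 0 (longRunCov P X)).real A| ≤ rho P X 𝒜 :=
    le_csSup hbdd ⟨A, hA, rfl⟩
  have h2 := h A hA
  rw [abs_le] at *
  constructor <;> linarith

/-! ### Sparsely convex sets -/

section Sparse

variable {p : ℕ}

/-- If C has interior points, this is Hahn–Banach. Otherwise C lies in a proper affine subspace, a
normal to which is constant on C and can be given the right sign. Closedness is not assumed, so the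
separation is only weak. -/
lemma exists_weak_separation {C : Set (RVec p)} (hC : Convex ℝ C) (hne : C.Nonempty)
    {w : RVec p} (hw : w ∉ C) : ∃ u : RVec p, u ≠ 0 ∧ ∀ a ∈ C, inner ℝ a u ≤ inner ℝ w u := by
  by_cases hint : (interior C).Nonempty
  · obtain ⟨f, hf, hfa⟩ := geometric_hahn_banach_of_nonempty_interior_point hC
      (fun h => hw (interior_subset h)) hint
    refine ⟨(InnerProductSpace.toDual ℝ (RVec p)).symm f, ?_, fun a ha => ?_⟩
    · simpa using hf
    · rw [real_inner_comm, real_inner_comm _ w, InnerProductSpace.toDual_symm_apply,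
        InnerProductSpace.toDual_symm_apply]
      exact hfa a ha
  · rw [hC.interior_nonempty_iff_affineSpan_eq_top,
      AffineSubspace.affineSpan_eq_top_iff_vectorSpan_eq_top_of_nonempty ℝ _ _ hne,
      ← Submodule.orthogonal_eq_bot_iff] at hint
    obtain ⟨u, hu, hu0⟩ := Submodule.exists_mem_ne_zero_of_ne_bot hint
    obtain ⟨a₀, ha₀⟩ := hne
    have hconst : ∀ a ∈ C, inner ℝ a u = inner ℝ a₀ u := fun a ha => by
      have := (Submodule.mem_orthogonal _ _).1 hu (a - a₀) (vsub_mem_vectorSpan ℝ ha ha₀)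
      rwa [inner_sub_left, sub_eq_zero] at this
    rcases le_total (inner ℝ a₀ u) (inner ℝ w u) with h | h
    · exact ⟨u, hu0, fun a ha => (hconst a ha).trans_le h⟩
    · refine ⟨-u, neg_ne_zero.2 hu0, fun a ha => ?_⟩
      rw [inner_neg_right, inner_neg_right, hconst a ha]
      linarith

/-- A point outside a convex set that depends only on the coordinates in `J` is weakly separated
from it by a unit vector supported on `J`. -/
lemma exists_sparse_separation {C : Set (RVec p)} (hC : Convex ℝ C) (hne : C.Nonempty)
    {J : Finset (Fin p)} (hJ : ∀ w w' : RVec p, (∀ j ∈ J, w j = w' j) → (w ∈ C ↔ w' ∈ C))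
    {w : RVec p} (hw : w ∉ C) : ∃ u : RVec p, ‖u‖ = 1 ∧ (∀ j ∉ J, u j = 0) ∧
      ∀ a ∈ C, inner ℝ a u ≤ inner ℝ w u := by
  obtain ⟨u, hu0, hu⟩ := exists_weak_separation hC hne hw
  have hn : 0 < ‖u‖ := norm_pos_iff.2 hu0
  obtain ⟨a, ha⟩ := hne
  -- C is invariant under translation along eⱼ for j outside J. If uⱼ were nonzero, a translate of a
  -- would reach the value ⟨w, u⟩ + 1.
  have hsupp : ∀ j ∉ J, u j = 0 := by
    intro j hj
    by_contra huj
    set r : ℝ := (inner ℝ w u - inner ℝ a u + 1) / u j with hr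
    have hmem : a + EuclideanSpace.single j r ∈ C := (hJ _ _ fun i hi => by
      have hij : i ≠ j := fun h => hj (h ▸ hi)
      simp [hij]).1 ha
    have := hu _ hmem
    rw [inner_add_left, EuclideanSpace.inner_single_left] at this
    simp only [conj_trivial] at this
    rw [hr, div_mul_cancel₀ _ huj] at this
    linarith
  refine ⟨‖u‖⁻¹ • u, ?_, fun j hj => ?_, fun a ha => ?_⟩
  · rw [norm_smul, norm_inv, norm_norm, inv_mul_cancel₀ hn.ne']
  · simp [hsupp j hj]
  · rw [real_inner_smul_right, real_inner_smul_right]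
    exact mul_le_mul_of_nonneg_left (hu a ha) (inv_nonneg.2 hn.le)

/-- The unit vectors supported on the range of `q.1` whose coordinates there lie in the grid cell
`q.2` of side `1 / m`. -/
def InGridCell (s m : ℕ) (q : (Fin s → Fin p) × (Fin s → Fin (2 * m + 1))) (u : RVec p) : Prop :=
  ‖u‖ = 1 ∧ (∀ j, (∀ i, q.1 i ≠ j) → u j = 0) ∧ ∀ i, ⌊u (q.1 i) * m⌋ + m = (q.2 i : ℕ)

lemma InGridCell.l0Norm_le {s m : ℕ} {q : (Fin s → Fin p) × (Fin s → Fin (2 * m + 1))}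
    {u : RVec p} (h : InGridCell s m q u) : l0Norm u ≤ s := by
  have hsub : (Finset.univ.filter fun j => u j ≠ 0) ⊆ Finset.univ.image q.1 := fun j hj => by
    by_contra hcon
    refine (Finset.mem_filter.1 hj).2 (h.2.1 j fun i hi => hcon ?_)
    exact Finset.mem_image.2 ⟨i, Finset.mem_univ i, hi⟩
  calc l0Norm u ≤ (Finset.univ.image q.1).card := Finset.card_le_card hsub
    _ ≤ s := Finset.card_image_le.trans (by simp)

lemma InGridCell.abs_inner_sub_le {s m : ℕ} (hm : 0 < m)
    {q : (Fin s → Fin p) × (Fin s → Fin (2 * m + 1))} {u v : RVec p} (hu : InGridCell s m q u)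
    (hv : InGridCell s m q v) {R : ℝ} {w : RVec p} (hw : ∀ j, |w j| ≤ R) :
    |inner ℝ w u - inner ℝ w v| ≤ s * (R / m) := by
  classical
  have hm' : (0 : ℝ) < m := by exact_mod_cast hm
  have hdiff : ∀ i, |u (q.1 i) - v (q.1 i)| ≤ 1 / m := fun i => by
    have e : ⌊u (q.1 i) * m⌋ = ⌊v (q.1 i) * m⌋ := by
      have h1 := hu.2.2 i
      have h2 := hv.2.2 i
      linarith
    have := (Int.abs_sub_lt_one_of_floor_eq_floor e).le
    rwa [← sub_mul, abs_mul, abs_of_pos hm', ← le_div_iff₀ hm'] at this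
  rw [← inner_sub_right, inner_eq_dotProduct, dotProduct]
  have hR : ∀ j : Fin p, 0 ≤ R := fun j => (abs_nonneg _).trans (hw j)
  calc |∑ j, w.ofLp j * (u - v).ofLp j|
      = |∑ j ∈ Finset.univ.image q.1, w.ofLp j * (u - v).ofLp j| := by
        congr 1
        refine (Finset.sum_subset (Finset.subset_univ _) fun j _ hj => ?_).symm
        have hj' : ∀ i, q.1 i ≠ j := fun i hi =>
          hj (Finset.mem_image.2 ⟨i, Finset.mem_univ i, hi⟩)
        simp [hu.2.1 j hj', hv.2.1 j hj']
    _ ≤ ∑ j ∈ Finset.univ.image q.1, R / m := by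
        refine (Finset.abs_sum_le_sum_abs _ _).trans (Finset.sum_le_sum fun j hj => ?_)
        obtain ⟨i, -, rfl⟩ := Finset.mem_image.1 hj
        rw [abs_mul, div_eq_mul_one_div]
        exact mul_le_mul (hw _) (hdiff i) (abs_nonneg _) (hR (q.1 i))
    _ ≤ s * (R / m) := by
        rw [Finset.sum_const, nsmul_eq_mul]
        rcases (Finset.univ.image q.1).eq_empty_or_nonempty with h | ⟨j, -⟩
        · rcases isEmpty_or_nonempty (Fin s) with hs | ⟨⟨i⟩⟩
          · have : s = 0 := by
              have := Fintype.card_eq_zero_iff.2 hs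
              rwa [Fintype.card_fin] at this
            simp [this]
          · exact absurd h (Finset.Nonempty.ne_empty ⟨q.1 i, by simp⟩)
        · refine mul_le_mul_of_nonneg_right ?_ (div_nonneg (hR j) hm'.le)
          exact_mod_cast Finset.card_image_le.trans (by simp)

lemma exists_inGridCell {s m : ℕ} (hs : s ≤ p) {J : Finset (Fin p)} (hJ : J.card ≤ s)
    {u : RVec p} (hu : ‖u‖ = 1) (huJ : ∀ j ∉ J, u j = 0) : ∃ q, InGridCell s m q u := by
  -- The support is padded to exactly s coordinates so that `Fin s` can enumerate it; this is where
  -- s ≤ p is used.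
  obtain ⟨J', hJJ', -, hJ'⟩ := Finset.exists_subsuperset_card_eq (Finset.subset_univ J) hJ
    (by simpa using hs)
  have hbound : ∀ j, 0 ≤ ⌊u j * m⌋ + m ∧ ⌊u j * m⌋ + m < 2 * m + 1 := fun j => by
    have h := abs_le.1 (abs_apply_le_one hu j)
    have hm0 : (0 : ℝ) ≤ m := Nat.cast_nonneg m
    have h1 : -(m : ℤ) ≤ ⌊u j * m⌋ := Int.le_floor.2 (by push_cast; nlinarith [h.1])
    have h2 : ⌊u j * m⌋ ≤ (m : ℤ) := by
      have : (⌊u j * m⌋ : ℝ) ≤ (m : ℝ) := (Int.floor_le _).trans (by nlinarith [h.2])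
      exact_mod_cast this
    omega
  refine ⟨(fun i => J'.orderEmbOfFin hJ' i, fun i =>
    ⟨(⌊u (J'.orderEmbOfFin hJ' i) * m⌋ + m).toNat, ?_⟩), hu, fun j hj => huJ j fun hjJ => ?_,
    fun i => ?_⟩
  · have := hbound (J'.orderEmbOfFin hJ' i)
    omega
  · have : j ∈ Set.range (J'.orderEmbOfFin hJ') := by
      rw [Finset.range_orderEmbOfFin]
      exact hJJ' hjJ
    obtain ⟨i, hi⟩ := this
    exact hj i hi
  · exact (Int.toNat_of_nonneg (hbound _).1).symm

/-- A finite family of sparse unit vectors which is dense among the sparse unit vectors. -/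
lemma exists_sparse_net {s m : ℕ} (hs : s ≤ p) (hm : 0 < m) :
    ∃ (ι : Type) (_ : Fintype ι) (v : ι → RVec p),
      Fintype.card ι ≤ (p * (2 * m + 1)) ^ s ∧ (∀ i, ‖v i‖ = 1) ∧ (∀ i, l0Norm (v i) ≤ s) ∧
      ∀ (J : Finset (Fin p)) (u : RVec p), J.card ≤ s → ‖u‖ = 1 → (∀ j ∉ J, u j = 0) →
        ∃ i, ∀ (R : ℝ) (w : RVec p), (∀ j, |w j| ≤ R) →
          |inner ℝ w u - inner ℝ w (v i)| ≤ s * (R / m) := by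
  classical
  -- One representative is taken from each nonempty cell, so the net itself consists of sparse unit
  -- vectors.
  choose v hv using fun i : {q : (Fin s → Fin p) × (Fin s → Fin (2 * m + 1)) //
    ∃ u : RVec p, InGridCell s m q u} => i.2
  refine ⟨_, inferInstance, v, ?_, fun i => (hv i).1, fun i => (hv i).l0Norm_le,
    fun J u hJ hu huJ => ?_⟩
  · refine (Fintype.card_subtype_le _).trans (le_of_eq ?_)
    simp [mul_pow]
  · obtain ⟨q, hq⟩ := exists_inGridCell (m := m) hs hJ hu huJ
    exact ⟨⟨q, u, hq⟩, fun R w hw => hq.abs_inner_sub_le hm (hv ⟨q, u, hq⟩) hw⟩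

/-- A sparsely convex set is, inside a box, sandwiched between a polyhedron with sparse normals and
its enlargement. -/
lemma exists_sparse_sandwich {s m : ℕ} (hs : s ≤ p) (hm : 0 < m) {R ε : ℝ}
    (hε : s * (R / m) ≤ ε / 4) (hε0 : 0 < ε) {A : Set (RVec p)}
    (hA : A ∈ sparselyConvexSets p s) :
    (A ⊆ {w | ∀ j, |w j| ≤ R}ᶜ) ∨
    ∃ (ι : Type) (_ : Fintype ι) (v : ι → RVec p) (b : ι → ℝ),
      Fintype.card ι ≤ (p * (2 * m + 1)) ^ s ∧ (∀ i, ‖v i‖ = 1) ∧ (∀ i, l0Norm (v i) ≤ s) ∧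
      polyhedron v b \ {w | ∀ j, |w j| ≤ R}ᶜ ⊆ A ∧
      A \ {w | ∀ j, |w j| ≤ R}ᶜ ⊆ polyhedron v fun i => b i + ε := by
  set E : Set (RVec p) := {w | ∀ j, |w j| ≤ R} with hE
  obtain ⟨-, K, -, C, hconv, hdep, rfl⟩ := hA
  rcases Set.eq_empty_or_nonempty ((⋂ q, C q) ∩ E) with hem | hne
  · exact Or.inl (Set.subset_compl_iff_disjoint_right.2 (Set.disjoint_iff_inter_eq_empty.2 hem))
  right
  obtain ⟨ι, hι, v, hcard, hv1, hvs, hnet⟩ := exists_sparse_net hs hm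
  set A' : Set (RVec p) := (⋂ q, C q) ∩ E with hA'
  have hbdd : ∀ i, BddAbove ((fun a => inner ℝ a (v i)) '' A') := fun i => by
    refine ⟨p * R, ?_⟩
    rintro _ ⟨a, ⟨-, ha⟩, rfl⟩
    simp only [inner_eq_dotProduct, dotProduct]
    calc ∑ j, a.ofLp j * (v i).ofLp j ≤ ∑ _j : Fin p, R := Finset.sum_le_sum fun j _ => by
          refine (le_abs_self _).trans ?_
          rw [abs_mul]
          calc _ ≤ R * 1 := mul_le_mul (ha j) (abs_apply_le_one (hv1 i) j) (abs_nonneg _)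
                ((abs_nonneg _).trans (ha j))
            _ = R := mul_one R
      _ = p * R := by simp
  -- The levels are the support values of A ∩ E lowered by ε, so the ε-enlargement contains A ∩ E at
  -- once. If a box point w of the polyhedron missed some C q, take its sparse separating vector, a
  -- net vector and a point a within ε/4 of the supremum. Then sup − ε/4 < ⟨a, vᵢ⟩ ≤ ⟨w, vᵢ⟩ + ε/2 ≤
  -- sup − ε/2, a contradiction. The number of convex factors plays no role.
  refine ⟨ι, hι, v, fun i => sSup ((fun a => inner ℝ a (v i)) '' A') - ε, hcard, hv1, hvs, ?_, ?_⟩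
  · rintro w ⟨hw, hwE⟩
    rw [Set.notMem_compl_iff] at hwE
    refine Set.mem_iInter.2 fun q => ?_
    by_contra hwq
    obtain ⟨J, hJ, hJdep⟩ := hdep q
    obtain ⟨a₀, ha₀⟩ := hne
    obtain ⟨u, hu1, huJ, hsep⟩ := exists_sparse_separation (hconv q)
      ⟨a₀, Set.mem_iInter.1 ha₀.1 q⟩ hJdep hwq
    obtain ⟨i, hi⟩ := hnet J u hJ hu1 huJ
    obtain ⟨_, ⟨a, ha, rfl⟩, hlt⟩ := exists_lt_of_lt_csSup
      (Set.Nonempty.image (fun a => inner ℝ a (v i)) (⟨a₀, ha₀⟩ : A'.Nonempty))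
      (sub_lt_self (sSup ((fun a => inner ℝ a (v i)) '' A')) (by linarith : 0 < ε / 4))
    have h1 := hsep a (Set.mem_iInter.1 ha.1 q)
    have h2 := abs_le.1 ((hi R a ha.2).trans hε)
    have h3 := abs_le.1 ((hi R w hwE).trans hε)
    have h4 := hw i
    simp only at hlt h4
    linarith [h2.1, h2.2, h3.1, h3.2]
  · rintro w ⟨hw, hwE⟩
    rw [Set.notMem_compl_iff] at hwE
    intro i
    have := le_csSup (hbdd i) ⟨w, ⟨hw, hwE⟩, rfl⟩
    simpa using this

/-- A set of coordinates never has more than p elements. This allows s > p in the theorem although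
the net requires s ≤ p. -/
lemma sparselyConvexSets_subset_min (p s : ℕ) :
    sparselyConvexSets p s ⊆ sparselyConvexSets p (min s p) := by
  rintro A ⟨hA, K, hK, C, hconv, hdep, rfl⟩
  refine ⟨hA, K, hK, C, hconv, fun q => ?_, rfl⟩
  obtain ⟨J, hJ, h⟩ := hdep q
  exact ⟨J, le_min hJ (by simpa using Finset.card_le_univ J), h⟩

end Sparse

/-! ### The three classes of sets -/

section Classes

variable {p : ℕ}

/-- The signed coordinate vectors. -/
noncomputable def signedBasis (q : Fin p × Bool) : RVec p :=
  if q.2 then EuclideanSpace.single q.1 1 else -EuclideanSpace.single q.1 1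

lemma inner_signedBasis (w : RVec p) (q : Fin p × Bool) :
    inner ℝ w (signedBasis q) = if q.2 then w q.1 else -w q.1 := by
  unfold signedBasis
  split_ifs <;> simp [EuclideanSpace.inner_single_right]

lemma bilin_single (M : Matrix (Fin p) (Fin p) ℝ) (i j : Fin p) :
    (EuclideanSpace.single i (1 : ℝ)).ofLp ⬝ᵥ (M *ᵥ (EuclideanSpace.single j (1 : ℝ)).ofLp) =
      M i j := by
  simp

lemma bilin_signedBasis_self (M : Matrix (Fin p) (Fin p) ℝ) (q : Fin p × Bool) :
    (signedBasis q).ofLp ⬝ᵥ (M *ᵥ (signedBasis q).ofLp) = M q.1 q.1 := by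
  unfold signedBasis
  split_ifs <;> simp [mulVec_neg]

lemma abs_bilin_signedBasis (M : Matrix (Fin p) (Fin p) ℝ) (q r : Fin p × Bool) :
    |(signedBasis q).ofLp ⬝ᵥ (M *ᵥ (signedBasis r).ofLp)| = |M q.1 r.1| := by
  unfold signedBasis
  split_ifs <;> simp [mulVec_neg]

lemma hyperRectangle_eq (a b : Fin p → EReal) :
    {w : RVec p | ∀ j, a j ≤ ((w j : ℝ) : EReal) ∧ ((w j : ℝ) : EReal) ≤ b j} =
      {w | ∀ q : Fin p × Bool, ((inner ℝ w (signedBasis q) : ℝ) : EReal) ≤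
        if q.2 then b q.1 else -a q.1} := by
  ext w
  simp only [Set.mem_ofPred_eq, Prod.forall, Bool.forall_bool, inner_signedBasis]
  refine forall_congr' fun j => ?_
  simp [EReal.neg_le_neg_iff]

lemma half_lt_log {p : ℕ} (hp : 2 ≤ p) : 1 / 2 < Real.log p := by
  have h1 := Real.log_two_gt_d9
  have h2 : Real.log 2 ≤ Real.log p := Real.log_le_log (by norm_num) (by exact_mod_cast hp)
  linarith

lemma mul_rpow_le_of_le_one {r x e : ℝ} (hr : 1 ≤ r) (hx : 0 ≤ x) (he1 : e ≤ 1) :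
    (r * x) ^ e ≤ r * x ^ e := by
  rw [Real.mul_rpow (by linarith) hx]
  exact mul_le_mul_of_nonneg_right (Real.rpow_le_self_of_one_le hr he1) (by positivity)

/-- Gaussian comparison over hyper-rectangles. -/
theorem exists_abs_measureReal_hyperRectangle_sub_le : ∃ C : ℝ, 0 < C ∧
    ∀ {p : ℕ} {S T : Matrix (Fin p) (Fin p) ℝ} {K : ℝ}, 2 ≤ p → S.PosSemidef → T.PosSemidef →
      0 < K → (∀ j, K ≤ S j j) → ∀ A ∈ hyperRectangles p,
      |(multivariateGaussian 0 T).real A - (multivariateGaussian 0 S).real A| ≤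
        C * (1 + (Real.sqrt K)⁻¹) *
          (supNorm (T - S) ^ (1 / 3 : ℝ) * Real.log p ^ (2 / 3 : ℝ)) := by
  obtain ⟨C, hC, hmain⟩ := exists_abs_measureReal_sub_le_of_sandwich_ereal
  refine ⟨2 * C, by positivity, ?_⟩
  rintro p S T K hp hS hT hK hSK A ⟨a, b, hab, rfl⟩
  have hlog := half_lt_log hp
  have hΔ := supNorm_nonneg (T - S)
  have hKi : 0 < (Real.sqrt K)⁻¹ := inv_pos.2 (Real.sqrt_pos.2 hK)
  rw [hyperRectangle_eq]
  set c : Fin p × Bool → EReal := fun q => if q.2 then b q.1 else -a q.1 with hc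
  by_cases hbot : ∃ q, c q = ⊥
  · obtain ⟨q, hq⟩ := hbot
    have hem : {w : RVec p | ∀ q : Fin p × Bool,
        ((inner ℝ w (signedBasis q) : ℝ) : EReal) ≤ c q} = ∅ := by
      refine Set.eq_empty_of_forall_notMem fun w hw => ?_
      have := hw q
      rw [hq, le_bot_iff] at this
      exact EReal.coe_ne_bot _ this
    rw [hem]
    simp only [measureReal_empty, sub_self, abs_zero]
    positivity
  · rw [not_exists] at hbot
    -- There are 2p ≤ p² constraints because p ≥ 2, hence L = 2 log p.
    have hcard : (Fintype.card (Fin p × Bool) : ℝ) ≤ Real.exp (2 * Real.log p) := by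
      rw [two_mul, Real.exp_add]
      have hp' : (2 : ℝ) ≤ p := by exact_mod_cast hp
      rw [Real.exp_log (by linarith)]
      simp only [Fintype.card_prod, Fintype.card_fin, Fintype.card_bool]
      push_cast
      nlinarith
    have key := hmain signedBasis c hS hT hK
      (fun q => by rw [bilin_signedBasis_self]; exact hSK _) (L := 2 * Real.log p)
      (by linarith) hcard hΔ
      (fun q r => by rw [abs_bilin_signedBasis]; exact abs_apply_le_supNorm _ _ _) le_rfl hbot
      subset_rfl (by simp)
    refine key.trans ?_
    rw [zero_mul, add_zero]
    have h1 := mul_rpow_le_of_le_one (r := 2) (x := Real.log p) (e := 2 / 3) (by norm_num)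
      (by linarith) (by norm_num)
    have h2 : supNorm (T - S) ^ (1 / 3 : ℝ) * (2 * Real.log p) ^ (2 / 3 : ℝ) ≤
        supNorm (T - S) ^ (1 / 3 : ℝ) * (2 * Real.log p ^ (2 / 3 : ℝ)) :=
      mul_le_mul_of_nonneg_left h1 (by positivity)
    calc _ ≤ C * (1 + (Real.sqrt K)⁻¹) *
          (supNorm (T - S) ^ (1 / 3 : ℝ) * (2 * Real.log p ^ (2 / 3 : ℝ))) :=
          mul_le_mul_of_nonneg_left h2 (by positivity)
      _ = _ := by ring

lemma log_natCast_le_of_rpow_le {κ : ℝ} (hκ : 0 < κ) {n p : ℕ} (hn : 1 ≤ n)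
    (hnp : (n : ℝ) ^ κ ≤ p) : Real.log n ≤ κ⁻¹ * Real.log p := by
  have hn0 : (0 : ℝ) < n := by exact_mod_cast hn
  have h := Real.log_le_log (by positivity) hnp
  rw [Real.log_rpow hn0] at h
  rw [inv_mul_eq_div, le_div_iff₀ hκ]
  linarith

/-- Gaussian comparison over simple convex sets. -/
theorem exists_abs_measureReal_simpleConvexSet_sub_le {κ : ℝ} (hκ : 0 < κ) : ∃ C : ℝ, 0 < C ∧
    ∀ {n p : ℕ} {S T : Matrix (Fin p) (Fin p) ℝ} {K a d Δ : ℝ}, 1 ≤ n → 2 ≤ p →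
      (n : ℝ) ^ κ ≤ p → S.PosSemidef → T.PosSemidef → 0 < K → 0 ≤ a → 0 < d →
      1 ≤ d * Real.log p → ∀ (Q : GeneratedSet p) (A : Set (RVec p)), SimpleApprox n a d Q A →
      (∀ v ∈ Q.normals, K ≤ v.ofLp ⬝ᵥ (S *ᵥ v.ofLp)) → 0 ≤ Δ →
      (∀ v ∈ Q.normals, ∀ w ∈ Q.normals, |v.ofLp ⬝ᵥ ((T - S) *ᵥ w.ofLp)| ≤ Δ) →
      |(multivariateGaussian 0 T).real A - (multivariateGaussian 0 S).real A| ≤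
        C * (1 + (Real.sqrt K)⁻¹) *
          (a / n * (d * Real.log p) ^ (1 / 2 : ℝ) +
            Δ ^ (1 / 3 : ℝ) * (d * Real.log p) ^ (2 / 3 : ℝ)) := by
  obtain ⟨C, hC, hmain⟩ := exists_abs_measureReal_sub_le_of_sandwich_ereal
  refine ⟨(1 + κ⁻¹) * C, by positivity, ?_⟩
  intro n p S T K a d Δ hn hp hnp hS hT hK ha hd hdp Q A hQA hQK hΔ hQΔ
  have hlog := half_lt_log hp
  have hKi : 0 < (Real.sqrt K)⁻¹ := inv_pos.2 (Real.sqrt_pos.2 hK)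
  have hκi : 0 < κ⁻¹ := inv_pos.2 hκ
  have hn0 : (0 : ℝ) < n := by exact_mod_cast hn
  have hp0 : (0 : ℝ) < p := by positivity
  obtain ⟨hcard, hsub, hsup⟩ := hQA
  set c : {v // v ∈ Q.normals} → EReal := fun v => supportFn Q.carrier v with hc
  -- A support value ⊥ means that the generated set is empty. Its enlargement is then empty too,
  -- since ⊥ + ε = ⊥, and so is A.
  by_cases hbot : ∃ v, c v = ⊥
  · obtain ⟨v, hv⟩ := hbot
    have hem : A = ∅ := by
      refine Set.eq_empty_of_forall_notMem fun w hw => ?_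
      have := hsup hw v v.2
      have hv' : supportFn Q.carrier v = ⊥ := hv
      rw [hv', EReal.bot_add, le_bot_iff] at this
      exact EReal.coe_ne_bot _ this
    rw [hem]
    simp only [measureReal_empty, sub_self, abs_zero]
    positivity
  · rw [not_exists] at hbot
    -- From n^κ ≤ p, the bound (pn)^d is at most exp of this number.
    set L : ℝ := (1 + κ⁻¹) * (d * Real.log p) with hL
    have hL1 : 1 ≤ L := by
      rw [hL]
      nlinarith
    have hcard' : (Fintype.card {v // v ∈ Q.normals} : ℝ) ≤ Real.exp L := by
      rw [Fintype.card_coe]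
      refine hcard.trans ?_
      rw [Real.rpow_def_of_pos (by positivity), Real.exp_le_exp, Real.log_mul hp0.ne' hn0.ne', hL]
      have := log_natCast_le_of_rpow_le hκ hn hnp
      nlinarith
    have key := hmain (fun v : {v // v ∈ Q.normals} => v.1) c hS hT hK
      (fun v => hQK v v.2) (L := L) (by linarith) hcard' hΔ
      (fun v w => hQΔ v v.2 w w.2) (ε := a / n) (by positivity) (A := A) hbot
      (fun w hw => hsub (by
        rw [Q.carrier_eq]
        exact fun v hv => hw ⟨v, hv⟩))
      (fun w hw v => hsup hw v v.2)
    refine key.trans ?_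
    have h1 := mul_rpow_le_of_le_one (r := 1 + κ⁻¹) (x := d * Real.log p) (e := 2 / 3)
      (by linarith) (by linarith) (by norm_num)
    have h2 := mul_rpow_le_of_le_one (r := 1 + κ⁻¹) (x := d * Real.log p) (e := 1 / 2)
      (by linarith) (by linarith) (by norm_num)
    calc _ ≤ C * (1 + (Real.sqrt K)⁻¹) *
          (Δ ^ (1 / 3 : ℝ) * ((1 + κ⁻¹) * (d * Real.log p) ^ (2 / 3 : ℝ)) +
            a / n * ((1 + κ⁻¹) * (d * Real.log p) ^ (1 / 2 : ℝ))) := by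
          rw [hL]
          gcongr
      _ = _ := by ring

/-! ### Tail mass outside a box, and the comparison for sparsely convex sets -/

lemma measureReal_abs_eval_gt_le {S : Matrix (Fin p) (Fin p) ℝ} (hS : S.PosSemidef) {R : ℝ}
    (hR : 0 < R) (j : Fin p) :
    (multivariateGaussian 0 S).real {w | R < |w j|} ≤ S j j / R ^ 2 := by
  have hmem : MemLp (fun w : RVec p => w j) 2 (multivariateGaussian 0 S) :=
    memLp_eval (Y := id) IsGaussian.memLp_two_id j
  have h := meas_ge_le_variance_div_sq hmem hR
  have h0 : ∫ w : RVec p, w j ∂(multivariateGaussian 0 S) = 0 := by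
    simpa [EuclideanSpace.inner_single_right] using
      integral_inner_multivariateGaussian (S := S) (EuclideanSpace.single j 1)
  rw [h0, variance_eval_multivariateGaussian hS] at h
  have hle : (multivariateGaussian 0 S) {w : RVec p | R < |w j|} ≤
      ENNReal.ofReal (S j j / R ^ 2) :=
    (measure_mono (Set.ofPred_subset_ofPred.2 fun w hw => by simpa using hw.le)).trans h
  exact ENNReal.toReal_le_of_le_ofReal
    (div_nonneg (hS.diag_nonneg) (sq_nonneg R)) hle

lemma measureReal_box_compl_le {S : Matrix (Fin p) (Fin p) ℝ} (hS : S.PosSemidef) {R V : ℝ}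
    (hR : 0 < R) (hV : ∀ j, S j j ≤ V) :
    (multivariateGaussian 0 S).real {w : RVec p | ∀ j, |w j| ≤ R}ᶜ ≤ p * (V / R ^ 2) := by
  have e : {w : RVec p | ∀ j, |w j| ≤ R}ᶜ = ⋃ j, {w : RVec p | R < |w j|} := by
    ext w
    simp
  rw [e]
  refine (measureReal_iUnion_fintype_le _).trans ?_
  calc _ ≤ ∑ _j : Fin p, V / R ^ 2 := Finset.sum_le_sum fun j _ =>
        (measureReal_abs_eval_gt_le hS hR j).trans
          (div_le_div_of_nonneg_right (hV j) (sq_nonneg R))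
    _ = _ := by simp

lemma box_mem_hyperRectangles {R : ℝ} (hR : 0 ≤ R) :
    {w : RVec p | ∀ j, |w j| ≤ R} ∈ hyperRectangles p := by
  refine ⟨fun _ => ((-R : ℝ) : EReal), fun _ => (R : EReal), fun _ => ?_, ?_⟩
  · rw [EReal.coe_le_coe_iff]
    linarith
  · ext w
    simp only [Set.mem_ofPred_eq, EReal.coe_le_coe_iff, abs_le]

lemma measurableSet_box (R : ℝ) : MeasurableSet {w : RVec p | ∀ j, |w j| ≤ R} := by
  rw [Set.ofPred_forall]
  exact MeasurableSet.iInter fun j => measurableSet_le (by fun_prop) measurable_const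

/-- The mass outside a box of side `2 p n²` when the variances are at most `12 n B²`. -/
lemma measureReal_large_box_compl_le {S : Matrix (Fin p) (Fin p) ℝ} (hS : S.PosSemidef) {n : ℕ}
    (hn : 1 ≤ n) (hp : 1 ≤ p) {B : ℝ} (hB : 1 ≤ B) (hV : ∀ j, S j j ≤ 12 * n * B ^ 2) :
    (multivariateGaussian 0 S).real {w : RVec p | ∀ j, |w j| ≤ p * (n : ℝ) ^ 2}ᶜ ≤
      12 * (B / n) := by
  have hn1 : (1 : ℝ) ≤ n := by exact_mod_cast hn
  have hp1 : (1 : ℝ) ≤ p := by exact_mod_cast hp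
  -- For B ≤ n, Chebyshev and a union bound give 12 B²/(p n³) ≤ 12 B/n. For B > n the right-hand
  -- side exceeds 1.
  rcases le_or_gt B n with hBn | hBn
  · refine (measureReal_box_compl_le hS (by positivity) hV).trans ?_
    rw [mul_div_assoc', div_le_iff₀ (by positivity)]
    have e : 12 * (B / n) * (p * (n : ℝ) ^ 2) ^ 2 = p * (12 * n * B ^ 2) *
        (p * (n / B) * n) := by
      field_simp
    rw [e]
    refine le_mul_of_one_le_right (by positivity) ?_
    have h1 : 1 ≤ n / B := (one_le_div (by linarith)).2 hBn
    exact one_le_mul_of_one_le_of_one_le (one_le_mul_of_one_le_of_one_le hp1 h1) hn1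
  · have h1 : 1 ≤ B / n := (one_le_div (by linarith)).2 hBn.le
    exact measureReal_le_one.trans (by linarith)

lemma norm_single_one_and_l0Norm_le (j : Fin p) :
    ‖(EuclideanSpace.single j (1 : ℝ) : RVec p)‖ = 1 ∧
      l0Norm (EuclideanSpace.single j (1 : ℝ) : RVec p) ≤ 1 := by
  refine ⟨by simp, ?_⟩
  have : (Finset.univ.filter fun i : Fin p => (EuclideanSpace.single j (1 : ℝ)) i ≠ 0) ⊆ {j} :=
    fun i hi => by
      by_contra hij
      rw [Finset.mem_singleton] at hij
      exact (Finset.mem_filter.1 hi).2 (by simp [hij])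
  exact (Finset.card_le_card this).trans (by simp)

/-- The logarithm of the size of the net used for sparsely convex sets. -/
lemma sparse_net_card_le {κ : ℝ} (hκ : 0 < κ) {n s : ℕ} (hn : 1 ≤ n) (hp : 2 ≤ p)
    (hnp : (n : ℝ) ^ κ ≤ p) (hsp : s ≤ p) :
    ((p : ℝ) * (2 * (4 * s * p * n ^ 3 : ℕ) + 1)) ^ s ≤
      Real.exp ((7 + 3 * κ⁻¹) * (s * Real.log p)) := by
  have hn1 : (1 : ℝ) ≤ n := by exact_mod_cast hn
  have hp2 : (2 : ℝ) ≤ p := by exact_mod_cast hp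
  have hn3 : (1 : ℝ) ≤ (n : ℝ) ^ 3 := one_le_pow₀ hn1
  have h2 : (p : ℝ) * (2 * (4 * s * p * n ^ 3 : ℕ) + 1) ≤ 2 ^ 4 * (p : ℝ) ^ 3 * (n : ℝ) ^ 3 := by
    push_cast
    have hspn : (s : ℝ) * p * n ^ 3 ≤ p * p * n ^ 3 := by
      have : (s : ℝ) ≤ p := by exact_mod_cast hsp
      gcongr
    have hone : (1 : ℝ) ≤ p * p * n ^ 3 :=
      one_le_mul_of_one_le_of_one_le (by nlinarith) hn3
    calc _ = (p : ℝ) * (8 * (s * p * n ^ 3) + 1) := by ring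
      _ ≤ (p : ℝ) * (8 * (p * p * n ^ 3) + 8 * (p * p * n ^ 3)) :=
          mul_le_mul_of_nonneg_left (by linarith) (by linarith)
      _ = _ := by ring
  -- The 7 is 4 + 3, from 2⁴ ≤ p⁴ and p³; the term 3κ⁻¹ comes from n³.
  have h3 : (2 : ℝ) ^ 4 * (p : ℝ) ^ 3 * (n : ℝ) ^ 3 ≤
      Real.exp ((7 + 3 * κ⁻¹) * Real.log p) := by
    rw [← Real.log_le_iff_le_exp (by positivity), Real.log_mul (by positivity) (by positivity),
      Real.log_mul (by positivity) (by positivity), Real.log_pow, Real.log_pow, Real.log_pow]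
    have h4 := log_natCast_le_of_rpow_le hκ hn hnp
    have h5 : Real.log 2 ≤ Real.log p := Real.log_le_log (by norm_num) hp2
    push_cast
    linarith
  calc _ ≤ Real.exp ((7 + 3 * κ⁻¹) * Real.log p) ^ s :=
        pow_le_pow_left₀ (by positivity) (h2.trans h3) s
    _ = _ := by
        rw [← Real.exp_nat_mul]
        congr 1
        ring

/-- Converts the polyhedral rate with Δ replaced by s²Δ and L = r s l. The true power of s in the
first term is 2/3 + 2/3, rounded up to 2. -/
lemma sparse_rate_le {s : ℕ} (hs : 1 ≤ s) {r l Δ x : ℝ} (hr : 1 ≤ r) (hl : 0 ≤ l) (hΔ : 0 ≤ Δ)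
    (hx : 0 ≤ x) :
    ((s : ℝ) ^ 2 * Δ) ^ (1 / 3 : ℝ) * (r * (s * l)) ^ (2 / 3 : ℝ) +
        x * (r * (s * l)) ^ (1 / 2 : ℝ) ≤
      r * ((s : ℝ) ^ 2 * Δ ^ (1 / 3 : ℝ) * l ^ (2 / 3 : ℝ) + x * (s * l ^ (1 / 2 : ℝ))) := by
  have hs1 : (1 : ℝ) ≤ s := by exact_mod_cast hs
  have hs0 : (0 : ℝ) ≤ s := by positivity
  have q1 : ((s : ℝ) ^ 2 * Δ) ^ (1 / 3 : ℝ) ≤ s * Δ ^ (1 / 3 : ℝ) := by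
    rw [Real.mul_rpow (by positivity) hΔ, ← Real.rpow_natCast, ← Real.rpow_mul hs0]
    exact mul_le_mul_of_nonneg_right (Real.rpow_le_self_of_one_le hs1 (by norm_num))
      (by positivity)
  have q2 : ∀ e : ℝ, e ≤ 1 → (r * (s * l)) ^ e ≤ r * (s * l ^ e) := fun e he =>
    (mul_rpow_le_of_le_one hr (by positivity) he).trans
      (mul_le_mul_of_nonneg_left (mul_rpow_le_of_le_one hs1 hl he) (by positivity))
  have h1 := mul_le_mul q1 (q2 (2 / 3) (by norm_num)) (by positivity) (by positivity)
  have h2 := mul_le_mul_of_nonneg_left (q2 (1 / 2) (by norm_num)) hx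
  refine (add_le_add h1 h2).trans (le_of_eq ?_)
  ring

/-- Gaussian comparison over sparsely convex sets. -/
theorem exists_abs_measureReal_sparselyConvexSet_sub_le {κ : ℝ} (hκ : 0 < κ) : ∃ C : ℝ, 0 < C ∧
    ∀ {n p s : ℕ} {S T : Matrix (Fin p) (Fin p) ℝ} {K B : ℝ}, 1 ≤ n → 2 ≤ p →
      (n : ℝ) ^ κ ≤ p → S.PosSemidef → T.PosSemidef → 0 < K → 1 ≤ s → s ≤ p → 1 ≤ B →
      (∀ v : RVec p, ‖v‖ = 1 → l0Norm v ≤ s → K ≤ v.ofLp ⬝ᵥ (S *ᵥ v.ofLp)) →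
      (∀ j, S j j ≤ 12 * n * B ^ 2) → ∀ A ∈ sparselyConvexSets p s,
      |(multivariateGaussian 0 T).real A - (multivariateGaussian 0 S).real A| ≤
        C * (1 + (Real.sqrt K)⁻¹) *
          ((s : ℝ) ^ 2 * supNorm (T - S) ^ (1 / 3 : ℝ) * Real.log p ^ (2 / 3 : ℝ) +
            (B + s * Real.log p ^ (1 / 2 : ℝ)) / n) := by
  obtain ⟨C₁, hC₁, hsand⟩ := exists_abs_measureReal_sub_le_of_sandwich
  obtain ⟨C₂, hC₂, hrect⟩ := exists_abs_measureReal_hyperRectangle_sub_le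
  set r : ℝ := 7 + 3 * κ⁻¹ with hr
  refine ⟨r * C₁ + C₂ + 24, by positivity, ?_⟩
  intro n p s S T K B hn hp hnp hS hT hK hs hsp hB hSK hSV A hA
  have hlog := half_lt_log hp
  have hKi : 0 < (Real.sqrt K)⁻¹ := inv_pos.2 (Real.sqrt_pos.2 hK)
  have hκi : 0 < κ⁻¹ := inv_pos.2 hκ
  have hn1 : (1 : ℝ) ≤ n := by exact_mod_cast hn
  have hp2 : (2 : ℝ) ≤ p := by exact_mod_cast hp
  have hs1 : (1 : ℝ) ≤ s := by exact_mod_cast hs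
  have hr7 : 7 ≤ r := by rw [hr]; linarith [hκi]
  set Δ := supNorm (T - S) with hΔdef
  have hΔ : 0 ≤ Δ := supNorm_nonneg _
  set l := Real.log p with hl
  set Y := Δ ^ (1 / 3 : ℝ) * l ^ (2 / 3 : ℝ) with hY
  have hY0 : 0 ≤ Y := by positivity
  set R : ℝ := p * n ^ 2 with hR
  have hR0 : 0 < R := by positivity
  set E : Set (RVec p) := {w | ∀ j, |w j| ≤ R} with hE
  have hES : (multivariateGaussian 0 S).real Eᶜ ≤ 12 * (B / n) :=
    measureReal_large_box_compl_le hS hn (by linarith) hB hSV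
  have hdiag : ∀ j, K ≤ S j j := fun j => by
    obtain ⟨h1, h2⟩ := norm_single_one_and_l0Norm_le j
    have := hSK _ h1 (h2.trans hs)
    rwa [bilin_single] at this
  -- No variance bound is available for T, but the box is a hyper-rectangle, so the rectangle
  -- comparison transfers the estimate from S.
  have hET : (multivariateGaussian 0 T).real Eᶜ ≤
      12 * (B / n) + C₂ * (1 + (Real.sqrt K)⁻¹) * Y := by
    have h := hrect hp hS hT hK hdiag E (box_mem_hyperRectangles hR0.le)
    rw [measureReal_compl (measurableSet_box R), probReal_univ] at hES ⊢
    linarith [(abs_le.1 h).1]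
  have hZ : 0 ≤ (B + s * l ^ (1 / 2 : ℝ)) / n := by positivity
  have hs2Y : Y ≤ (s : ℝ) ^ 2 * Δ ^ (1 / 3 : ℝ) * l ^ (2 / 3 : ℝ) := by
    rw [mul_assoc]
    exact le_mul_of_one_le_left hY0 (one_le_pow₀ hs1)
  have hBZ : B / n ≤ (B + s * l ^ (1 / 2 : ℝ)) / n :=
    div_le_div_of_nonneg_right (le_add_of_nonneg_right (by positivity)) (by linarith)
  set Y' := (s : ℝ) ^ 2 * Δ ^ (1 / 3 : ℝ) * l ^ (2 / 3 : ℝ) with hY'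
  set Z := (B + s * l ^ (1 / 2 : ℝ)) / n with hZdef
  have hcompl : (multivariateGaussian 0 S).real Eᶜ + (multivariateGaussian 0 T).real Eᶜ ≤
      (C₂ + 24) * (1 + (Real.sqrt K)⁻¹) * (Y' + Z) := by
    have h1 : C₂ * (1 + (Real.sqrt K)⁻¹) * Y ≤ C₂ * (1 + (Real.sqrt K)⁻¹) * (Y' + Z) := by
      gcongr
      linarith
    have h2 : 24 * Z ≤ 24 * (1 + (Real.sqrt K)⁻¹) * (Y' + Z) := by
      nlinarith [mul_nonneg hKi.le (add_nonneg (hY0.trans hs2Y) hZ)]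
    linarith
  -- This mesh gives s R / m = 1/(4n) for R = p n², exactly what the sandwich needs with ε = 1/n.
  set m : ℕ := 4 * s * p * n ^ 3 with hm
  have hm0 : 0 < m := by positivity
  have hmR : s * (R / m) ≤ (1 / (n : ℝ)) / 4 := by
    rw [hR, hm]
    push_cast
    refine le_of_eq ?_
    field_simp
  have hsand0 : 0 ≤ r * C₁ * (1 + (Real.sqrt K)⁻¹) * (Y' + Z) := by positivity
  rcases exists_sparse_sandwich hsp hm0 hmR (by positivity) hA with hAE |
    ⟨ι, _, v, b, hcard, hv1, hvs, hlo, hhi⟩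
  · have h1 : (multivariateGaussian 0 S).real A ≤ (multivariateGaussian 0 S).real Eᶜ :=
      measureReal_mono hAE
    have h2 : (multivariateGaussian 0 T).real A ≤ (multivariateGaussian 0 T).real Eᶜ :=
      measureReal_mono hAE
    have h3 : 0 ≤ (multivariateGaussian 0 S).real A := measureReal_nonneg
    have h4 : 0 ≤ (multivariateGaussian 0 T).real A := measureReal_nonneg
    have e : (r * C₁ + C₂ + 24) * (1 + (Real.sqrt K)⁻¹) * (Y' + Z) =
        r * C₁ * (1 + (Real.sqrt K)⁻¹) * (Y' + Z) +
          (C₂ + 24) * (1 + (Real.sqrt K)⁻¹) * (Y' + Z) := by ring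
    rw [e, abs_le]
    constructor <;> linarith
  · set L : ℝ := r * (s * l) with hL
    have hL1 : 1 / 2 ≤ L := by
      rw [hL]
      have : 1 / 2 ≤ s * l := by nlinarith
      nlinarith
    have hcard' : (Fintype.card ι : ℝ) ≤ Real.exp L := by
      have h1 : (Fintype.card ι : ℝ) ≤ ((p : ℝ) * (2 * m + 1)) ^ s := by exact_mod_cast hcard
      exact h1.trans (sparse_net_card_le hκ hn hp hnp hsp)
    have key := hsand v b hS hT hK (fun i => hSK _ (hv1 i) (hvs i)) hL1 hcard'
      (Δ := (s : ℝ) ^ 2 * Δ) (by positivity)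
      (fun i j => abs_bilin_le_of_l0Norm_le _ (hv1 i) (hv1 j) (hvs i) (hvs j))
      (ε := 1 / n) (by positivity) hlo hhi
    have q4 := sparse_rate_le hs (r := r) (l := l) (Δ := Δ) (x := 1 / n)
      (by linarith only [hr7]) (by linarith only [hlog]) hΔ (by positivity)
    have hsZ : 1 / (n : ℝ) * (s * l ^ (1 / 2 : ℝ)) ≤ Z := by
      rw [one_div, inv_mul_eq_div, hZdef]
      exact div_le_div_of_nonneg_right (le_add_of_nonneg_left (zero_le_one.trans hB))
        (Nat.cast_nonneg n)
    have q6 : r * (Y' + 1 / (n : ℝ) * (s * l ^ (1 / 2 : ℝ))) ≤ r * (Y' + Z) :=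
      mul_le_mul_of_nonneg_left (add_le_add_right hsZ Y') (by linarith only [hr7])
    have q5 := mul_le_mul_of_nonneg_left (q4.trans q6)
      (by positivity : 0 ≤ C₁ * (1 + (Real.sqrt K)⁻¹))
    have e : (r * C₁ + C₂ + 24) * (1 + (Real.sqrt K)⁻¹) * (Y' + Z) =
        C₁ * (1 + (Real.sqrt K)⁻¹) * (r * (Y' + Z)) +
          (C₂ + 24) * (1 + (Real.sqrt K)⁻¹) * (Y' + Z) := by ring
    rw [e]
    linarith only [key, q5, hcompl]

end Classes

end HDBootstrap

/-! ### Assembly of the three comparisons -/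

theorem theorem10 (κ γ₁ K₃ K₄ K₅ : ℝ) (hκ : 0 < κ) (hγ₁ : 1 ≤ γ₁)
    (hK₃ : 0 < K₃) (hK₄ : 0 < K₄) (hK₅ : 0 < K₅) :
    ∃ c : ℝ, 0 < c ∧
      ∀ (n p : ℕ), 1 ≤ n → 2 ≤ p → (n : ℝ) ^ κ ≤ (p : ℝ) →
      ∀ (Ω : Type*) [MeasurableSpace Ω] (P : Measure Ω) [IsProbabilityMeasure P]
        -- centred data with finite second moments
        (X : Fin n → Ω → RVec p), (∀ t, Measurable (X t)) →
        (∀ t, MemLp (X t) 2 P) → (∀ t, ∫ ω, X t ω ∂P = 0) →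
      ∀ -- the estimated covariance matrix, a function of the data
        (Xihat : (Fin n → RVec p) → Matrix (Fin p) (Fin p) ℝ),
        (∀ i j, Measurable fun x => Xihat x i j) →
        (∀ᵐ ω ∂P, (Xihat (sample X ω)).PosSemidef) →
      ∀ -- the bootstrap vector, with conditional law N(0, Xihat) given the data
        (Ghat : Ω → RVec p), Measurable Ghat →
        (∀ᵐ ω ∂P, condDistrib Ghat (sample X) P (sample X ω) =
          multivariateGaussian 0 (Xihat (sample X ω))) →
      -- (i) hyper-rectangles
      ((∀ j, K₃ ≤ coordLongRunVar P X j) →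
        ∀ᵐ ω ∂P, rhoHat P X Ghat (hyperRectangles p) ω ≤
          c * (rho P X (hyperRectangles p) +
            (supNorm (Xihat (sample X ω) - longRunCov P X)) ^ (1 / 3 : ℝ) *
              (Real.log p) ^ (2 / 3 : ℝ))) ∧
      -- (ii) simple convex sets
      (∀ (a d : ℝ), 0 ≤ a → 0 < d → 1 ≤ d * Real.log p →
        ∀ (𝒜 : Set (Set (RVec p))) (AK : Set (RVec p) → GeneratedSet p),
        𝒜 ⊆ simpleConvexSets n p a d →
        (∀ A ∈ 𝒜, SimpleApprox n a d (AK A) A) →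
        (∀ A ∈ 𝒜, ∀ v ∈ (AK A).normals, K₄ ≤ dirLongRunVar P X v) →
        ∀ᵐ ω ∂P, rhoHat P X Ghat 𝒜 ω ≤
          c * (rho P X 𝒜 + a / n * (d * Real.log p) ^ (1 / 2 : ℝ) +
            (deltaOver AK 𝒜 (Xihat (sample X ω) - longRunCov P X)) ^ (1 / 3 : ℝ) *
              (d * Real.log p) ^ (2 / 3 : ℝ))) ∧
      -- (iii) sparsely convex sets
      (∀ (s : ℕ) (B : ℝ), 1 ≤ s → 1 ≤ B →
        (∀ t j, psiNorm P γ₁ (fun ω => X t ω j) ≤ ENNReal.ofReal B) →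
        (∀ v : RVec p, ‖v‖ = 1 → l0Norm v ≤ s → K₅ ≤ dirLongRunVar P X v) →
        ∀ᵐ ω ∂P, rhoHat P X Ghat (sparselyConvexSets p s) ω ≤
          c * (rho P X (sparselyConvexSets p s) +
            (s : ℝ) ^ 2 * (supNorm (Xihat (sample X ω) - longRunCov P X)) ^ (1 / 3 : ℝ) *
              (Real.log p) ^ (2 / 3 : ℝ) +
            (B + s * (Real.log p) ^ (1 / 2 : ℝ)) / n)) := by
  obtain ⟨C₁, hC₁, hrect⟩ := exists_abs_measureReal_hyperRectangle_sub_le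
  obtain ⟨C₂, hC₂, hsimple⟩ := exists_abs_measureReal_simpleConvexSet_sub_le hκ
  obtain ⟨C₃, hC₃, hsparse⟩ := exists_abs_measureReal_sparselyConvexSet_sub_le hκ
  set c₁ := C₁ * (1 + (Real.sqrt K₃)⁻¹) with hc₁
  set c₂ := C₂ * (1 + (Real.sqrt K₄)⁻¹) with hc₂
  set c₃ := C₃ * (1 + (Real.sqrt K₅)⁻¹) with hc₃
  have p₁ : 0 ≤ c₁ := by positivity
  have p₂ : 0 ≤ c₂ := by positivity
  have p₃ : 0 ≤ c₃ := by positivity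
  refine ⟨1 + c₁ + c₂ + c₃, by positivity, ?_⟩
  intro n p hn hp hnp Ω _ P _ X hX hX2 _ Xihat _ hpsd Ghat _ hcond
  have hS := posSemidef_longRunCov hX2
  have hl : 0 ≤ Real.log p := by linarith [half_lt_log hp]
  have combine : ∀ {x y z c : ℝ}, 0 ≤ y → 0 ≤ z → c ≤ c₁ + c₂ + c₃ → x ≤ y + c * z →
      x ≤ (1 + c₁ + c₂ + c₃) * (y + z) := fun {x y z c} hy hz hc h => by
    have h1 := mul_le_mul_of_nonneg_right hc hz
    have h2 : 0 ≤ (c₁ + c₂ + c₃) * y := mul_nonneg (by positivity) hy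
    linarith
  refine ⟨fun hvar => ?_, ?_, ?_⟩
  · filter_upwards [hpsd, hcond] with ω hT hω
    have hΔ := supNorm_nonneg (Xihat (sample X ω) - longRunCov P X)
    exact combine (rho_nonneg P X _) (by positivity) (by linarith)
      (rhoHat_le_rho_add hX hω (by positivity) fun A hA =>
        hrect hp hS hT hK₃ (fun j => (hvar j).trans_eq (longRunCov_self hX2 j).symm) A hA)
  · intro a d ha hd hdp 𝒜 AK _ hAK hvar
    filter_upwards [hpsd, hcond] with ω hT hω
    have hΔ := deltaOver_nonneg AK 𝒜 (Xihat (sample X ω) - longRunCov P X)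
    rw [add_assoc (rho P X 𝒜)]
    exact combine (rho_nonneg P X _) (by positivity) (by linarith)
      (rhoHat_le_rho_add hX hω (by positivity) fun A hA =>
        hsimple hn hp hnp hS hT hK₄ ha hd hdp (AK A) A (hAK A hA)
          (fun v hv => (hvar A hA v hv).trans_eq (dotProduct_longRunCov hX2 v).symm) hΔ
          fun v hv w hw => abs_bilin_le_deltaOver AK _ hA hv hw)
  · intro s B hs hB hpsi hvar
    filter_upwards [hpsd, hcond] with ω hT hω
    have hΔ := supNorm_nonneg (Xihat (sample X ω) - longRunCov P X)
    have hB0 : 0 < B := by linarith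
    rw [add_assoc (rho P X _)]
    refine combine (rho_nonneg P X _) (by positivity) (by linarith)
      (rhoHat_le_rho_add (r := c₃ * _) hX hω (by positivity) fun A hA => ?_)
    -- The comparison is applied with min s p in place of s, and the resulting rate is increasing in
    -- the sparsity.
    refine (hsparse hn hp hnp hS hT hK₅ (le_min hs (by omega)) (min_le_right s p) hB
      (fun v hv hvs => (hvar v hv (hvs.trans (min_le_left s p))).trans_eq
        (dotProduct_longRunCov hX2 v).symm)
      (longRunCov_self_le hX hX2 hγ₁ hB0 hpsi) A (sparselyConvexSets_subset_min p s hA)).trans ?_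
    have hmin : ((min s p : ℕ) : ℝ) ≤ s := by exact_mod_cast min_le_left s p
    rw [← hc₃]
    gcongr
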